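/- **Definitions.** An *MO-graph* is a finite 4-regular map (a graph, loops and multiple edges allowed, with a clockwise cyclic order of the half-edges at each vertex) in which every half-edge carries a sign $+$ or $-$, such that the two halves of each edge have opposite signs and any two half-edges that are consecutive around a vertex have opposite signs. A *rooted MO-graph* is a connected MO-graph with a marked edge (the root-edge), in the middle of which a fake vertex of degree $2$, the *root-vertex*, is inserted, so that the root-edge is cut into two edges; the *rooted cycle-graph*, which has no vertex other than the root-vertex and whose only edge is a loop at the root-vertex, also counts as a rooted MO-graph. Rooted MO-graphs are considered up to isomorphism (bijections of half-edges that preserve the root-vertex, signs, cyclic orders and edges). Edges are directed from their positive half to their negative half. Each edge carries a left, a straight and a right strand, running along its left side, its middle and its right side, for the direction of the edge. At each vertex other than the root-vertex, at each corner the two external strands bordering that corner are joined (both are left strands or both are right strands), and the straight strands of opposite half-edges are joined; at the root-vertex all three strands go through. The *faces* are the closed walks formed by strands; they are left, right or straight, and their length is the number of edges they follow. The *degree* $\delta$ is defined by $2\delta = 6c+3V-2F$, where $c$ is the number of connected components, $V$ the number of vertices (the root-vertex not counted) and $F$ the number of faces of all three types. A *melon* of a rooted MO-graph is a triple edge $(e_1,e_2,e_3)$,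 none of the three edges being part of the root-edge, such that $(e_1,e_2)$ form a left face of length $2$, $(e_2,e_3)$ form a right face of length $2$ and $(e_1,e_3)$ form a straight face of length $2$. Its *removal* erases $e_1,e_2,e_3$ and their two end-vertices $a,b$, and merges the remaining edge entering $\{a,b\}$ and the remaining edge leaving $\{a,b\}$ into one directed edge. A rooted MO-graph is *melon-free* if it has no melon, and *melonic* if it can be reduced to the rooted cycle-graph by successive removals of melons. *Substituting* an edge $e$, directed from $u$ to $v$, by a rooted MO-graph $G'$ means cutting $e$, erasing the root-vertex of $G'$, joining the half-edge of $e$ at $u$ to the edge of $G'$ that left the root-vertex, and joining the edge of $G'$ that entered the root-vertex to the half-edge of $e$ at $v$; if $G'$ is the rooted cycle-graph, $e$ is unchanged. **Proposition.** For every rooted MO-graph $G$ there are a rooted melon-free MO-graph $H$ (the *melon-free core* of $G$) and, for each edge $e$ of $H$ (the edges incident to the root-vertex included), a rooted melonic MO-graph $G_e$, such that $G$ is isomorphic to the graph obtained from $H$ by substituting each edge $e$ by $G_e$. They are unique: if $H'$ and $(G'_{e})_{e}$, with $e$ running over the edges of $H'$, have the same properties, then there is an isomorphism $\varphi : H\to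 H'$ such that $G_e$ is isomorphic to $G'_{\varphi(e)}$ for every edge $e$ of $H$. Moreover, $G$ and $H$ have the same degree. -/

import Mathlib

universe u

/-- The three types of strands carried by every half-edge, hence the three types of faces. -/
inductive StrandType where
  | left
  | right
  | straight

/-- An MO-graph with a root-vertex, not necessarily connected.

It has finitely many ordinary vertices, all of degree `4`, and one extra "fake" vertex of degree
`2`, the root-vertex, which sits in the middle of the root-edge.  `D` is the set of half-edges at
the ordinary vertices; the root-vertex has two half-edges, a positive one `Sum.inr true` and a
negative one `Sum.inr false`.  So the set of all half-edges is `D ⊕ Bool`.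

* `rot` sends a half-edge to the next one in clockwise order around its vertex; the ordinary
  vertices are the cycles of `rot`, all of length `4`;
* `pos d = true` means that `d` carries the sign `+`; signs alternate around each vertex;
* `opp` sends a half-edge to the other half of its edge; the two halves have opposite signs. -/
structure MarkedMOGraph where
  D : Type u
  finite : Finite D
  rot : Equiv.Perm D
  pos : D → Bool
  opp : D ⊕ Bool → D ⊕ Bool
  rot_four : ∀ d, rot (rot (rot (rot d))) = d
  rot_two_ne : ∀ d, rot (rot d) ≠ d
  pos_rot : ∀ d, pos (rot d) = !pos d
  opp_opp : ∀ h, opp (opp h) = h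
  sign_opp : ∀ h, Sum.elim pos id (opp h) = !(Sum.elim pos id h)

namespace MarkedMOGraph

/-- All half-edges, including the two at the root-vertex. -/
abbrev Half (G : MarkedMOGraph.{u}) : Type u := G.D ⊕ Bool

/-- The sign of a half-edge (`true` for `+`, `false` for `-`). -/
def sign (G : MarkedMOGraph.{u}) : G.Half → Bool := Sum.elim G.pos id

/-- The next half-edge clockwise around the vertex, the root-vertex included. -/
def next (G : MarkedMOGraph.{u}) : G.Half → G.Half := Sum.map G.rot not

/-- Edges are directed from their positive half to their negative half.  An edge is given by its
positive half `e`; its negative half is `G.opp e`.  The root-edge counts as two edges (one if the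
graph has no ordinary vertex), since the root-vertex is inserted in its middle. -/
def Edge (G : MarkedMOGraph.{u}) : Type u := {h : G.Half // G.sign h = true}

/-- The half of the edge `e` that has sign `b`. -/
def halfOf (G : MarkedMOGraph.{u}) (e : G.Edge) (b : Bool) : G.Half :=
  if b = true then e.1 else G.opp e.1

theorem sign_opp_eq (G : MarkedMOGraph.{u}) (h : G.Half) : G.sign (G.opp h) = !(G.sign h) :=
  G.sign_opp h

/-- The edge to which a half-edge belongs. -/
def edgeOf (G : MarkedMOGraph.{u}) (h : G.Half) : G.Edge :=
  if hs : G.sign h = true then ⟨h, hs⟩ else ⟨G.opp h, by rw [G.sign_opp_eq]; simpa using hs⟩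

/-- How strands are routed at a vertex: a strand of type `t` of the half-edge `h` is joined at the
vertex to the strand of type `t` of `G.turn t h`.

The left strand is on the left side of a positive half-edge and on the right side of a negative
one (sides are seen from the vertex, so that the left side of `d` faces the preceding half-edge
in clockwise order, and the right side of `d` faces the next one); symmetrically for the right
strand; external strands turn at the corners.  The internal strand goes to the opposite half-edge.
At the root-vertex, which has degree `2`, all three strands go through. -/
def turn (G : MarkedMOGraph.{u}) : StrandType → G.Half → G.Half
  | _, Sum.inr b => Sum.inr (!b)
  | .left, Sum.inl d => Sum.inl (if G.pos d = true then G.rot.symm d else G.rot d)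
  | .right, Sum.inl d => Sum.inl (if G.pos d = true then G.rot d else G.rot.symm d)
  | .straight, Sum.inl d => Sum.inl (G.rot (G.rot d))

/-- Two half-edges whose strands of type `t` are consecutive, along an edge or at a vertex. -/
def StrandAdj (G : MarkedMOGraph.{u}) (t : StrandType) (x y : G.Half) : Prop :=
  y = G.opp x ∨ y = G.turn t x

/-- Two half-edges that share an edge or are consecutive around a vertex. -/
def Adj (G : MarkedMOGraph.{u}) (x y : G.Half) : Prop :=
  y = G.opp x ∨ y = G.next x

/-- The graph is connected. -/
def Connected (G : MarkedMOGraph.{u}) : Prop := ∀ x y : G.Half, Relation.EqvGen G.Adj x y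

/-- The number of connected components. -/
noncomputable def numComponents (G : MarkedMOGraph.{u}) : ℕ := Nat.card (Quot G.Adj)

/-- The number of ordinary vertices (the root-vertex does not count). -/
noncomputable def numVertices (G : MarkedMOGraph.{u}) : ℕ :=
  Nat.card (Quot fun x y : G.D => y = G.rot x)

/-- The number of faces of type `t`, that is, of closed walks formed by strands of type `t`. -/
noncomputable def numFacesOf (G : MarkedMOGraph.{u}) (t : StrandType) : ℕ :=
  Nat.card (Quot (G.StrandAdj t))

/-- The number of faces, straight faces included. -/
noncomputable def numFaces (G : MarkedMOGraph.{u}) : ℕ :=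
  G.numFacesOf .left + G.numFacesOf .right + G.numFacesOf .straight

/-- The degree `δ`, defined by `2 δ = 6 c + 3 V - 2 F`. -/
noncomputable def degree (G : MarkedMOGraph.{u}) : ℚ :=
  (6 * (G.numComponents : ℚ) + 3 * (G.numVertices : ℚ) - 2 * (G.numFaces : ℚ)) / 2

/-- The set of half-edges that the face of type `t` through the half-edge `h` passes by. -/
def faceThrough (G : MarkedMOGraph.{u}) (t : StrandType) (h : G.Half) : Set G.Half :=
  {x | Relation.EqvGen (G.StrandAdj t) h x}

/-- The edges `e` and `f` are distinct and form a face of type `t` of length `2`. -/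
def FormFace (G : MarkedMOGraph.{u}) (t : StrandType) (e f : G.Edge) : Prop :=
  e ≠ f ∧ G.faceThrough t e.1 = {e.1, G.opp e.1, f.1, G.opp f.1}

/-- The edge `e` is incident to the root-vertex. -/
def MeetsRoot (G : MarkedMOGraph.{u}) (e : G.Edge) : Prop :=
  e.1.isRight = true ∨ (G.opp e.1).isRight = true

/-- The edges `e₁, e₂, e₃` form a melon: none of them is (part of) the root-edge, and they form
a left face `(e₁, e₂)`, a right face `(e₂, e₃)` and a straight face `(e₁, e₃)`, all of length `2`.
(They are then automatically a triple edge.) -/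
structure IsMelon (G : MarkedMOGraph.{u}) (e₁ e₂ e₃ : G.Edge) : Prop where
  root₁ : ¬ G.MeetsRoot e₁
  root₂ : ¬ G.MeetsRoot e₂
  root₃ : ¬ G.MeetsRoot e₃
  left : G.FormFace .left e₁ e₂
  right : G.FormFace .right e₂ e₃
  straight : G.FormFace .straight e₁ e₃

/-- The graph has no melon. -/
def MelonFree (G : MarkedMOGraph.{u}) : Prop := ∀ e₁ e₂ e₃ : G.Edge, ¬ G.IsMelon e₁ e₂ e₃

/-- Two half-edges are at the same vertex. -/
def SameVertex (G : MarkedMOGraph.{u}) (x y : G.Half) : Prop :=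
  Relation.EqvGen (fun a b => b = G.next a) x y

/-- Isomorphisms of graphs with a root-vertex: bijections between the half-edges which fix the
half-edges at the root-vertex and preserve the signs, the rotations and the edges. -/
structure Iso (G G' : MarkedMOGraph.{u}) where
  toEquiv : G.D ≃ G'.D
  map_pos : ∀ d, G'.pos (toEquiv d) = G.pos d
  map_rot : ∀ d, G'.rot (toEquiv d) = toEquiv (G.rot d)
  map_opp : ∀ h, G'.opp (Sum.map toEquiv id h) = Sum.map toEquiv id (G.opp h)

/-- The action of an isomorphism on edges. -/
def Iso.mapEdge {G G' : MarkedMOGraph.{u}} (φ : Iso G G') (e : G.Edge) : G'.Edge :=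
  ⟨Sum.map φ.toEquiv id e.1, by
    obtain ⟨x, hx⟩ := e
    cases x with
    | inl d => exact (φ.map_pos d).trans hx
    | inr b => exact hx⟩

/-- `G'` is obtained from `G` by the removal of a melon `(e₁, e₂, e₃)`.

The end-vertices of the melon are `a` (the vertex at the positive half of `e₁`) and `b` (the
vertex at its negative half).  Since `e₂` is directed from `b` to `a`, the fourth half-edge at `a`
is opposite to the negative half of `e₂` and is negative, and the fourth half-edge at `b` is
opposite to the positive half of `e₂` and is positive.  The vertices `a` and `b` and the edges
`e₁, e₂, e₃` are erased, and the edge that ended at `a` and the one that started at `b` are merged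
into one edge; the rest is unchanged. -/
def IsMelonRemoval (G G' : MarkedMOGraph.{u}) : Prop :=
  ∃ e₁ e₂ e₃ : G.Edge, G.IsMelon e₁ e₂ e₃ ∧
    ∃ f : G'.D → G.D, Function.Injective f ∧
      (∀ d : G.D, d ∈ Set.range f ↔
        ¬ G.SameVertex e₁.1 (Sum.inl d) ∧ ¬ G.SameVertex (G.opp e₁.1) (Sum.inl d)) ∧
      (∀ d, G.pos (f d) = G'.pos d) ∧
      (∀ d, G.rot (f d) = f (G'.rot d)) ∧
      ∀ e : G'.Edge,
        G.opp (Sum.map f id e.1) = Sum.map f id (G'.opp e.1) ∨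
        (G.opp (Sum.map f id e.1) = G.turn .straight (G.opp e₂.1) ∧
          G.opp (G.turn .straight e₂.1) = Sum.map f id (G'.opp e.1))

/-- Half-edges of the graph `M e`, seen in the graph where each edge `e` of `H` is substituted by
`M e`.  The root-vertex of `M e` disappears: an edge of `M e` that arrives there at the half-edge
of sign `b` is prolonged to the half of `e` that has sign `b`. -/
def plug (H : MarkedMOGraph.{u}) (M : H.Edge → MarkedMOGraph.{u}) (e : H.Edge) :
    (M e).Half → (H.D ⊕ Σ e : H.Edge, (M e).D) ⊕ Bool
  | Sum.inl d => Sum.inl (Sum.inr ⟨e, d⟩)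
  | Sum.inr b => Sum.map Sum.inl id (H.halfOf e b)

/-- The edges of the graph where each edge `e` of `H` is substituted by `M e`: a half-edge of `H`
with sign `b`, on the edge `e`, takes the place of the half-edge of sign `b` at the root-vertex
of `M e`. -/
def substOpp (H : MarkedMOGraph.{u}) (M : H.Edge → MarkedMOGraph.{u}) :
    (H.D ⊕ Σ e : H.Edge, (M e).D) ⊕ Bool → (H.D ⊕ Σ e : H.Edge, (M e).D) ⊕ Bool
  | Sum.inl (Sum.inl d) => H.plug M (H.edgeOf (Sum.inl d))
      ((M (H.edgeOf (Sum.inl d))).opp (Sum.inr (H.sign (Sum.inl d))))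
  | Sum.inl (Sum.inr ⟨e, d⟩) => H.plug M e ((M e).opp (Sum.inl d))
  | Sum.inr b => H.plug M (H.edgeOf (Sum.inr b))
      ((M (H.edgeOf (Sum.inr b))).opp (Sum.inr (H.sign (Sum.inr b))))

theorem sign_halfOf (G : MarkedMOGraph.{u}) (e : G.Edge) (b : Bool) :
    G.sign (G.halfOf e b) = b := by
  cases b
  · simp [halfOf, G.sign_opp_eq, e.2]
  · simp [halfOf, e.2]

theorem edgeOf_halfOf (G : MarkedMOGraph.{u}) (e : G.Edge) (b : Bool) :
    G.edgeOf (G.halfOf e b) = e := by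
  have he := e.2
  apply Subtype.ext
  cases b
  · simp [edgeOf, halfOf, G.sign_opp_eq, he, G.opp_opp]
  · simp [edgeOf, halfOf, he]

theorem halfOf_edgeOf (G : MarkedMOGraph.{u}) (h : G.Half) :
    G.halfOf (G.edgeOf h) (G.sign h) = h := by
  by_cases hs : G.sign h = true
  · simp [edgeOf, halfOf, hs]
  · simp [edgeOf, halfOf, hs, G.opp_opp]

theorem opp_halfOf (G : MarkedMOGraph.{u}) (e : G.Edge) (b : Bool) :
    G.opp (G.halfOf e b) = G.halfOf e (!b) := by
  cases b <;> simp [halfOf, G.opp_opp]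

theorem substOpp_map (H : MarkedMOGraph.{u}) (M : H.Edge → MarkedMOGraph.{u}) (h : H.Half) :
    H.substOpp M (Sum.map Sum.inl id h) =
      H.plug M (H.edgeOf h) ((M (H.edgeOf h)).opp (Sum.inr (H.sign h))) := by
  cases h <;> rfl

theorem substOpp_plug (H : MarkedMOGraph.{u}) (M : H.Edge → MarkedMOGraph.{u}) (e : H.Edge)
    (x : (M e).Half) : H.substOpp M (H.plug M e x) = H.plug M e ((M e).opp x) := by
  cases x with
  | inl d => rfl
  | inr b =>
    change H.substOpp M (Sum.map Sum.inl id (H.halfOf e b)) = _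
    rw [substOpp_map, sign_halfOf, edgeOf_halfOf]

theorem exists_plug (H : MarkedMOGraph.{u}) (M : H.Edge → MarkedMOGraph.{u})
    (z : (H.D ⊕ Σ e : H.Edge, (M e).D) ⊕ Bool) : ∃ e x, z = H.plug M e x := by
  have key : ∀ h : H.Half, ∃ e x, Sum.map Sum.inl id h = H.plug M e x := fun h =>
    ⟨H.edgeOf h, Sum.inr (H.sign h), by
      change _ = Sum.map Sum.inl id (H.halfOf _ _)
      rw [halfOf_edgeOf]⟩
  rcases z with (d | ⟨e, d⟩) | b
  · exact key (Sum.inl d)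
  · exact ⟨e, Sum.inl d, rfl⟩
  · exact key (Sum.inr b)

theorem sign_plug (H : MarkedMOGraph.{u}) (M : H.Edge → MarkedMOGraph.{u}) (e : H.Edge)
    (x : (M e).Half) :
    Sum.elim (Sum.elim H.pos fun p : Σ e : H.Edge, (M e).D => (M p.1).pos p.2) id
      (H.plug M e x) = (M e).sign x := by
  cases x with
  | inl d => rfl
  | inr b =>
    have h1 := H.sign_halfOf e b
    change Sum.elim _ id (Sum.map Sum.inl id (H.halfOf e b)) = b
    generalize H.halfOf e b = h at h1
    cases h <;> exact h1

/-- The graph obtained from `H` by substituting every edge `e` by the graph `M e`: the edge `e`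
is cut in its middle, the root-vertex of `M e` is erased, and the edge of `M e` that left the
root-vertex now starts at the positive half of `e`, while the edge of `M e` that entered the
root-vertex now ends at the negative half of `e`.  If `M e` has no ordinary vertex, then `e` is
unchanged. -/
def subst (H : MarkedMOGraph.{u}) (M : H.Edge → MarkedMOGraph.{u}) : MarkedMOGraph.{u} where
  D := H.D ⊕ Σ e : H.Edge, (M e).D
  finite := by
    have := H.finite
    have : ∀ e, Finite (M e).D := fun e => (M e).finite
    have : Finite H.Edge := inferInstanceAs (Finite {h : H.Half // H.sign h = true})
    infer_instance
  rot := Equiv.sumCongr H.rot (Equiv.sigmaCongrRight fun e => (M e).rot)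
  pos := Sum.elim H.pos fun p => (M p.1).pos p.2
  opp := H.substOpp M
  rot_four := by
    rintro (d | ⟨e, d⟩)
    · simp [H.rot_four]
    · simp [(M e).rot_four]
  rot_two_ne := by
    rintro (d | ⟨e, d⟩)
    · simpa using H.rot_two_ne d
    · simpa using (M e).rot_two_ne d
  pos_rot := by
    rintro (d | ⟨e, d⟩)
    · simpa using H.pos_rot d
    · simpa using (M e).pos_rot d
  opp_opp := by
    intro z
    obtain ⟨e, x, rfl⟩ := H.exists_plug M z
    rw [substOpp_plug, substOpp_plug, (M e).opp_opp]
  sign_opp := by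
    intro z
    obtain ⟨e, x, rfl⟩ := H.exists_plug M z
    rw [substOpp_plug, sign_plug, sign_plug, sign_opp_eq]

/-- The walk along a left face, from one positive half-edge to the next one. -/
def leftStep (G : MarkedMOGraph.{u}) (h : G.Half) : G.Half := G.turn .left (G.opp h)

theorem pos_rot_symm (G : MarkedMOGraph.{u}) (d : G.D) : G.pos (G.rot.symm d) = !G.pos d := by
  have h := G.pos_rot (G.rot.symm d)
  rw [Equiv.apply_symm_apply] at h
  rw [h, Bool.not_not]

theorem sign_turn_left (G : MarkedMOGraph.{u}) (h : G.Half) :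
    G.sign (G.turn .left h) = !(G.sign h) := by
  cases h with
  | inr b => rfl
  | inl d =>
    by_cases hd : G.pos d = true
    · simp [turn, sign, hd, pos_rot_symm]
    · simp [turn, sign, hd, G.pos_rot]

theorem turn_left_turn_left (G : MarkedMOGraph.{u}) (h : G.Half) :
    G.turn .left (G.turn .left h) = h := by
  cases h with
  | inr b => simp [turn]
  | inl d =>
    by_cases hd : G.pos d = true
    · simp [turn, hd, pos_rot_symm]
    · simp [turn, hd, G.pos_rot]

theorem leftStep_injective (G : MarkedMOGraph.{u}) : Function.Injective G.leftStep := by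
  intro x y h
  have h1 := congrArg G.opp (congrArg (G.turn .left) h)
  simpa [leftStep, turn_left_turn_left, G.opp_opp] using h1

theorem sign_leftStep (G : MarkedMOGraph.{u}) (h : G.Half) :
    G.sign (G.leftStep h) = G.sign h := by
  simp [leftStep, sign_turn_left, sign_opp_eq]

theorem adj_turn_left (G : MarkedMOGraph.{u}) (d : G.D) :
    Relation.EqvGen G.Adj (Sum.inl d) (G.turn .left (Sum.inl d)) := by
  by_cases hd : G.pos d = true
  · refine Relation.EqvGen.symm _ _ (Relation.EqvGen.rel _ _ (Or.inr ?_))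
    simp [turn, next, hd]
  · refine Relation.EqvGen.rel _ _ (Or.inr ?_)
    simp [turn, next, hd]

theorem eqvGen_opp (G : MarkedMOGraph.{u}) (x : G.Half) :
    Relation.EqvGen G.Adj x (G.opp x) := Relation.EqvGen.rel _ _ (Or.inl rfl)

theorem subst_opp_plug (H : MarkedMOGraph.{u}) (M : H.Edge → MarkedMOGraph.{u}) (e : H.Edge)
    (x : (M e).Half) : (H.subst M).opp (H.plug M e x) = H.plug M e ((M e).opp x) :=
  H.substOpp_plug M e x

theorem subst_next_plug (H : MarkedMOGraph.{u}) (M : H.Edge → MarkedMOGraph.{u}) (e : H.Edge)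
    (d : (M e).D) : (H.subst M).next (H.plug M e (Sum.inl d)) =
      H.plug M e ((M e).next (Sum.inl d)) := rfl

theorem subst_turn_plug (H : MarkedMOGraph.{u}) (M : H.Edge → MarkedMOGraph.{u}) (e : H.Edge)
    (d : (M e).D) : (H.subst M).turn .left (H.plug M e (Sum.inl d)) =
      H.plug M e ((M e).turn .left (Sum.inl d)) := by
  refine congrArg Sum.inl ?_
  change _ = (Sum.inr ⟨e, if (M e).pos d = true then _ else _⟩ :
    H.D ⊕ Σ e : H.Edge, (M e).D)
  by_cases hd : (M e).pos d = true
  · rw [if_pos hd]; exact if_pos hd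
  · rw [if_neg hd]; exact if_neg hd

/-- The two halves of an edge of `H` stay connected in the substituted graph: follow the left face
of `M e` that passes by the root-vertex. -/
theorem subst_ends_connected (H : MarkedMOGraph.{u}) (M : H.Edge → MarkedMOGraph.{u})
    (e : H.Edge) : Relation.EqvGen (H.subst M).Adj (H.plug M e (Sum.inr true))
      (H.plug M e (Sum.inr false)) := by
  by_contra hne
  have key : ∀ k : ℕ,
      ((M e).sign ((M e).leftStep^[k + 1] (Sum.inr true)) = true) ∧
      (∃ d, (M e).leftStep^[k + 1] (Sum.inr true) = Sum.inl d) ∧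
      Relation.EqvGen (H.subst M).Adj (H.plug M e (Sum.inr true))
        (H.plug M e ((M e).leftStep^[k + 1] (Sum.inr true))) := by
    have step : ∀ x : (M e).Half, (M e).sign x = true →
        Relation.EqvGen (H.subst M).Adj (H.plug M e (Sum.inr true)) (H.plug M e x) →
        ((M e).sign ((M e).leftStep x) = true) ∧
        (∃ d, (M e).leftStep x = Sum.inl d) ∧
        Relation.EqvGen (H.subst M).Adj (H.plug M e (Sum.inr true))
          (H.plug M e ((M e).leftStep x)) := by
      intro x hx hc
      have hs : (M e).sign ((M e).opp x) = false := by rw [sign_opp_eq, hx]; rfl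
      have hc2 : Relation.EqvGen (H.subst M).Adj (H.plug M e (Sum.inr true))
          (H.plug M e ((M e).opp x)) := by
        refine hc.trans _ _ _ ?_
        rw [← subst_opp_plug]
        exact eqvGen_opp _ _
      refine ⟨by rw [sign_leftStep, hx], ?_⟩
      unfold leftStep
      rcases hy : (M e).opp x with d | b
      · rw [hy] at hc2
        refine ⟨⟨_, rfl⟩, hc2.trans _ _ _ ?_⟩
        rw [← subst_turn_plug]
        exact adj_turn_left (H.subst M) (Sum.inr ⟨e, d⟩)
      · rw [hy] at hs hc2
        have hb : b = false := hs
        subst hb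
        exact absurd hc2 hne
    intro k
    induction k with
    | zero => exact step _ rfl (Relation.EqvGen.refl _)
    | succ k ih =>
      rw [Function.iterate_succ_apply']
      exact step _ ih.1 ih.2.2
  have := (M e).finite
  have hper : (Sum.inr true : (M e).Half) ∈ Function.periodicPts (M e).leftStep :=
    Function.Injective.mem_periodicPts (M e).leftStep_injective _
  obtain ⟨n, hn, hp⟩ := hper
  obtain ⟨k, rfl⟩ : ∃ k, n = k + 1 := ⟨n - 1, by omega⟩
  obtain ⟨d, hd⟩ := (key k).2.1
  have hp2 : (M e).leftStep^[k + 1] (Sum.inr true) = Sum.inr true := hp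
  rw [hp2] at hd
  cases hd

theorem Connected.subst {H : MarkedMOGraph.{u}} {M : H.Edge → MarkedMOGraph.{u}}
    (hH : H.Connected) (hM : ∀ e, (M e).Connected) : (H.subst M).Connected := by
  have hin : ∀ (e : H.Edge) (x y : (M e).Half), Relation.EqvGen (M e).Adj x y →
      Relation.EqvGen (H.subst M).Adj (H.plug M e x) (H.plug M e y) := by
    intro e x y h
    induction h with
    | refl x => exact Relation.EqvGen.refl _
    | symm x y _ ih => exact ih.symm
    | trans x y z _ _ ih1 ih2 => exact ih1.trans _ _ _ ih2
    | rel x y h =>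
      rcases h with h | h
      · subst h
        rw [← subst_opp_plug]
        exact eqvGen_opp _ _
      · subst h
        cases x with
        | inl d =>
          rw [← subst_next_plug]
          exact Relation.EqvGen.rel _ _ (Or.inr rfl)
        | inr b =>
          cases b
          · exact (H.subst_ends_connected M e).symm
          · exact H.subst_ends_connected M e
  have hhalf : ∀ h : H.Half, H.plug M (H.edgeOf h) (Sum.inr (H.sign h)) =
      Sum.map Sum.inl id h := by
    intro h
    change Sum.map Sum.inl id (H.halfOf _ _) = _
    rw [halfOf_edgeOf]
  have hout : ∀ x y : H.Half, Relation.EqvGen H.Adj x y →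
      Relation.EqvGen (H.subst M).Adj (Sum.map Sum.inl id x) (Sum.map Sum.inl id y) := by
    intro x y h
    induction h with
    | refl x => exact Relation.EqvGen.refl _
    | symm x y _ ih => exact ih.symm
    | trans x y z _ _ ih1 ih2 => exact ih1.trans _ _ _ ih2
    | rel x y h =>
      rcases h with h | h
      · have h2 : Sum.map Sum.inl id y = H.plug M (H.edgeOf x) (Sum.inr (!(H.sign x))) := by
          change _ = Sum.map Sum.inl id (H.halfOf _ _)
          rw [← opp_halfOf, halfOf_edgeOf, h]
        have h3 := hin (H.edgeOf x) (Sum.inr (H.sign x)) (Sum.inr (!(H.sign x))) (hM _ _ _)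
        rw [← h2, hhalf] at h3
        exact h3
      · subst h
        refine Relation.EqvGen.rel _ _ (Or.inr ?_)
        cases x <;> rfl
  intro z w
  obtain ⟨e, x, rfl⟩ := H.exists_plug M z
  obtain ⟨f, y, rfl⟩ := H.exists_plug M w
  refine (hin e x (Sum.inr true) (hM e _ _)).trans _ _ _ ?_
  refine Relation.EqvGen.trans _ _ _ ?_ (hin f (Sum.inr true) y (hM f _ _))
  exact hout _ _ (hH _ _)

end MarkedMOGraph

/-- A rooted MO-graph: a connected MO-graph with a root-vertex in the middle of its root-edge (the
rooted cycle-graph, with no ordinary vertex, included). -/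
structure RootedMOGraph extends MarkedMOGraph.{u} where
  connected : toMarkedMOGraph.Connected

namespace RootedMOGraph

/-- The rooted cycle-graph: no ordinary vertex, and a single edge, which is a loop at the
root-vertex. -/
def cycleGraph : RootedMOGraph.{u} where
  D := PEmpty
  finite := inferInstance
  rot := Equiv.refl _
  pos := fun d => d.elim
  opp := Sum.map id not
  rot_four := fun d => d.elim
  rot_two_ne := fun d => d.elim
  pos_rot := fun d => d.elim
  opp_opp := by rintro (d | b) <;> simp
  sign_opp := by rintro (d | b) <;> first | exact d.elim | rfl
  connected := by
    rintro (d | b) (d' | b')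
    · exact d.elim
    · exact d.elim
    · exact d'.elim
    · cases b <;> cases b' <;>
        first | exact Relation.EqvGen.refl _ | exact Relation.EqvGen.rel _ _ (Or.inl rfl)

/-- Isomorphisms of rooted MO-graphs. -/
abbrev Iso (G G' : RootedMOGraph.{u}) := MarkedMOGraph.Iso G.toMarkedMOGraph G'.toMarkedMOGraph

/-- `G'` is obtained from `G` by the removal of a melon. -/
def IsMelonRemoval (G G' : RootedMOGraph.{u}) : Prop :=
  MarkedMOGraph.IsMelonRemoval G.toMarkedMOGraph G'.toMarkedMOGraph

/-- A rooted MO-graph is melonic if it can be reduced to the rooted cycle-graph by successive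
removals of melons. -/
def Melonic (G : RootedMOGraph.{u}) : Prop :=
  ∃ C : RootedMOGraph.{u}, Relation.ReflTransGen IsMelonRemoval G C ∧ Nonempty (Iso C cycleGraph)

/-- The rooted MO-graph obtained from `H` by substituting every edge `e` by `M e`. -/
def subst (H : RootedMOGraph.{u}) (M : H.Edge → RootedMOGraph.{u}) : RootedMOGraph.{u} where
  toMarkedMOGraph := H.toMarkedMOGraph.subst fun e => (M e).toMarkedMOGraph
  connected := MarkedMOGraph.Connected.subst H.connected fun e => (M e).connected

end RootedMOGraph

/-! Existence is an induction on the number of half-edges. If `G` has a melon, remove it and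
decompose the smaller graph as a substitution into a melon-free `H`. The merged edge left by the
melon lies in exactly one substituted piece. Putting the melon back inside that piece keeps it
melonic and recovers `G` without changing `H` (`exists_core`).

The degree is preserved at each removal. A melon accounts for two vertices and for one face of each
of the three types, and `3 * 2 - 2 * 3 = 0`. The number of components stays `1`
(`Removal.degree_eq`).

Uniqueness rests on two facts. First, if `H` is melon-free, every melon of a substituted graph lies
inside a single piece (`MelonFree.exists_piece`). A melon between two vertices of `H` would already
be a melon of `H`, and a melon cannot straddle `H` and a piece, because a piece has only one root
half-edge of each sign. Second, removals of melons are confluent. Distinct melons of a connected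
graph have no common vertex (`MelonAt.eq_or_disjoint`) and their removals commute
(`Removal.diamond`), so a melonic graph stays melonic whichever melon is removed
(`Melonic.removal`).

An isomorphism between two substituted graphs carries melons to melons, hence descends to the graphs
with one melon less on each side. The induction ends when no melon is left: then all pieces are
trivial and the isomorphism is one between the cores. On the way back, isomorphisms of pieces are
extended over the reinserted melons (`Removal.unique_insertion`, `core_unique`).

Throughout, melons are handled through two half-edges `a` and `b`, the positive and negative halves
of the first edge. The eight half-edges at the end-vertices are the rotations of `a` and `b`. Six of
them are matched among themselves. The other two are the inlet `rot a`, which is negative, and the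
outlet `rot (rot (rot b))`, which is positive. -/

namespace MarkedMOGraph

/-! ### Vertices as cycles of four half-edges, and melons seen locally -/

/-- `x` is a half-edge at the same ordinary vertex as `a`. -/
def AtVertex (G : MarkedMOGraph.{u}) (a x : G.D) : Prop :=
  x = a ∨ x = G.rot a ∨ x = G.rot (G.rot a) ∨ x = G.rot (G.rot (G.rot a))

attribute [simp] rot_four

theorem atVertex_self (G : MarkedMOGraph.{u}) (a : G.D) : G.AtVertex a a := Or.inl rfl

theorem AtVertex.rot {G : MarkedMOGraph.{u}} {a x : G.D} (h : G.AtVertex a x) :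
    G.AtVertex a (G.rot x) := by
  rcases h with rfl | rfl | rfl | rfl <;> simp [AtVertex]

theorem atVertex_rot_iff (G : MarkedMOGraph.{u}) (a x : G.D) :
    G.AtVertex a (G.rot x) ↔ G.AtVertex a x := by
  refine ⟨fun h => ?_, AtVertex.rot⟩
  simpa using h.rot.rot.rot

theorem AtVertex.symm {G : MarkedMOGraph.{u}} {a x : G.D} (h : G.AtVertex a x) :
    G.AtVertex x a := by
  rcases h with rfl | rfl | rfl | rfl <;> simp [AtVertex]

theorem AtVertex.trans {G : MarkedMOGraph.{u}} {a b c : G.D} (h : G.AtVertex a b)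
    (h' : G.AtVertex b c) : G.AtVertex a c := by
  rcases h' with rfl | rfl | rfl | rfl
  · exact h
  · exact h.rot
  · exact h.rot.rot
  · exact h.rot.rot.rot

theorem rot_symm_eq (G : MarkedMOGraph.{u}) (d : G.D) :
    G.rot.symm d = G.rot (G.rot (G.rot d)) := by
  rw [Equiv.symm_apply_eq, rot_four]

theorem rot_ne (G : MarkedMOGraph.{u}) (d : G.D) : G.rot d ≠ d := by
  intro h
  have := G.pos_rot d
  rw [h] at this
  simp at this

theorem rot_three_ne (G : MarkedMOGraph.{u}) (d : G.D) : G.rot (G.rot (G.rot d)) ≠ d := by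
  intro h
  have := congrArg G.rot h
  rw [rot_four] at this
  exact G.rot_ne d this.symm

theorem opp_ne (G : MarkedMOGraph.{u}) (h : G.Half) : G.opp h ≠ h := by
  intro e
  have := G.sign_opp_eq h
  rw [e] at this
  simp at this

theorem opp_eq_iff (G : MarkedMOGraph.{u}) (x y : G.Half) : G.opp x = y ↔ x = G.opp y := by
  constructor
  · rintro rfl; rw [G.opp_opp]
  · rintro rfl; rw [G.opp_opp]

theorem opp_injective (G : MarkedMOGraph.{u}) : Function.Injective G.opp := by
  intro x y h
  rw [opp_eq_iff, G.opp_opp] at h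
  exact h

/-- The local description of a melon: `a` and `b` are the positive and the negative half of its
first edge. -/
structure MelonAt (G : MarkedMOGraph.{u}) (a b : G.D) : Prop where
  pos : G.pos a = true
  ne : ¬ G.AtVertex a b
  opp₁ : G.opp (Sum.inl a) = Sum.inl b
  opp₂ : G.opp (Sum.inl (G.rot b)) = Sum.inl (G.rot (G.rot (G.rot a)))
  opp₃ : G.opp (Sum.inl (G.rot (G.rot a))) = Sum.inl (G.rot (G.rot b))

/-- A half-edge that is at neither of the vertices of `a` and `b`. -/
def Kept (G : MarkedMOGraph.{u}) (a b : G.D) : G.Half → Prop :=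
  Sum.elim (fun d => ¬ G.AtVertex a d ∧ ¬ G.AtVertex b d) fun _ => True

open Classical in
/-- Jump over the melon at `a` and `b`, from one of its external half-edges to the half-edge that
faces the other one. -/
noncomputable def bypass (G : MarkedMOGraph.{u}) (a b : G.D) (x : G.Half) : G.Half :=
  if x = Sum.inl (G.rot a) then G.opp (Sum.inl (G.rot (G.rot (G.rot b))))
  else if x = Sum.inl (G.rot (G.rot (G.rot b))) then G.opp (Sum.inl (G.rot a))
  else x

section Melon

variable {G : MarkedMOGraph.{u}} {a b : G.D}

theorem MelonAt.inlet_ne_outlet (m : G.MelonAt a b) : G.rot a ≠ G.rot (G.rot (G.rot b)) := by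
  intro h
  apply m.ne
  have : G.AtVertex b (G.rot a) := by rw [h]; exact (G.atVertex_self b).rot.rot.rot
  exact ((G.atVertex_rot_iff _ _).1 this).symm

theorem bypass_inlet : G.bypass a b (Sum.inl (G.rot a)) =
    G.opp (Sum.inl (G.rot (G.rot (G.rot b)))) := by
  simp [bypass]

theorem MelonAt.bypass_outlet (m : G.MelonAt a b) :
    G.bypass a b (Sum.inl (G.rot (G.rot (G.rot b)))) = G.opp (Sum.inl (G.rot a)) := by
  have := m.inlet_ne_outlet
  simp [bypass, this.symm]

theorem bypass_of_ne {x : G.Half} (h₁ : x ≠ Sum.inl (G.rot a))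
    (h₂ : x ≠ Sum.inl (G.rot (G.rot (G.rot b)))) : G.bypass a b x = x := by
  simp [bypass, h₁, h₂]

theorem bypass_of_kept {x : G.Half} (h : G.Kept a b x) : G.bypass a b x = x := by
  apply bypass_of_ne
  · rintro rfl
    exact h.1 (G.atVertex_self a).rot
  · rintro rfl
    exact h.2 (G.atVertex_self b).rot.rot.rot

theorem not_kept_iff {x : G.Half} :
    ¬ G.Kept a b x ↔ ∃ d, x = Sum.inl d ∧ (G.AtVertex a d ∨ G.AtVertex b d) := by
  rcases x with d | c
  · simp [Kept]; tauto
  · simp [Kept]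

theorem MelonAt.pos_b (m : G.MelonAt a b) : G.pos b = false := by
  have := G.sign_opp_eq (Sum.inl a)
  rw [m.opp₁] at this
  simpa [sign, m.pos] using this

/-- The half-edges at the end-vertices of a melon which are not external are matched. -/
theorem MelonAt.opp_of_not_kept (m : G.MelonAt a b) {x : G.Half} (h : ¬ G.Kept a b x) :
    x = Sum.inl (G.rot a) ∨ x = Sum.inl (G.rot (G.rot (G.rot b))) ∨
      ¬ G.Kept a b (G.opp x) ∧ G.opp x ≠ Sum.inl (G.rot a) ∧
        G.opp x ≠ Sum.inl (G.rot (G.rot (G.rot b))) := by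
  have h1 := m.opp₁
  have h2 := m.opp₂
  have h3 := m.opp₃
  have h1' := (G.opp_eq_iff _ _).1 h1
  have h2' := (G.opp_eq_iff _ _).1 h2
  have h3' := (G.opp_eq_iff _ _).1 h3
  have na : ∀ {x}, G.AtVertex a x → ¬ G.AtVertex b x := fun h h' => m.ne (h.trans h'.symm)
  have A := G.atVertex_self a
  have B := G.atVertex_self b
  obtain ⟨d, rfl, hd⟩ := not_kept_iff.1 h
  rcases hd with (rfl | rfl | rfl | rfl) | (rfl | rfl | rfl | rfl)
  · refine Or.inr (Or.inr ?_)
    rw [h1]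
    refine ⟨fun k => k.2 B, fun e => ?_, fun e => ?_⟩
    · exact na A.rot (Sum.inl.inj e ▸ B)
    · exact G.rot_three_ne b (Sum.inl.inj e).symm
  · exact Or.inl rfl
  · refine Or.inr (Or.inr ?_)
    rw [h3]
    refine ⟨fun k => k.2 B.rot.rot, fun e => ?_, fun e => ?_⟩
    · exact na A.rot (Sum.inl.inj e ▸ B.rot.rot)
    · exact G.rot_ne b (G.rot.injective (G.rot.injective (Sum.inl.inj e))).symm
  · refine Or.inr (Or.inr ?_)
    rw [← h2']
    refine ⟨fun k => k.2 B.rot, fun e => ?_, fun e => ?_⟩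
    · exact na A.rot (Sum.inl.inj e ▸ B.rot)
    · exact G.rot_two_ne b (G.rot.injective (Sum.inl.inj e)).symm
  · refine Or.inr (Or.inr ?_)
    rw [← h1']
    refine ⟨fun k => k.1 A, fun e => ?_, fun e => ?_⟩
    · exact G.rot_ne _ (Sum.inl.inj e).symm
    · exact na A ((Sum.inl.inj e) ▸ B.rot.rot.rot)
  · refine Or.inr (Or.inr ?_)
    rw [h2]
    refine ⟨fun k => k.1 A.rot.rot.rot, fun e => ?_, fun e => ?_⟩
    · exact G.rot_two_ne _ (Sum.inl.inj e)
    · exact na A.rot.rot.rot ((Sum.inl.inj e) ▸ B.rot.rot.rot)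
  · refine Or.inr (Or.inr ?_)
    rw [← h3']
    refine ⟨fun k => k.1 A.rot.rot, fun e => ?_, fun e => ?_⟩
    · exact G.rot_ne _ (Sum.inl.inj e)
    · exact na A.rot.rot ((Sum.inl.inj e) ▸ B.rot.rot.rot)
  · exact Or.inr (Or.inl rfl)

theorem not_kept_inlet : ¬ G.Kept a b (Sum.inl (G.rot a)) := fun k => k.1 (G.atVertex_self a).rot

theorem not_kept_outlet : ¬ G.Kept a b (Sum.inl (G.rot (G.rot (G.rot b)))) :=
  fun k => k.2 (G.atVertex_self b).rot.rot.rot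

/-- The internal half-edges of the melon are matched among themselves, so an edge coming from
outside can only reach the melon at its inlet or its outlet. -/
theorem MelonAt.opp_of_kept (m : G.MelonAt a b) {x : G.Half} (h : G.Kept a b x) :
    G.opp x = Sum.inl (G.rot a) ∨ G.opp x = Sum.inl (G.rot (G.rot (G.rot b))) ∨
      G.Kept a b (G.opp x) := by
  by_cases k : G.Kept a b (G.opp x)
  · exact Or.inr (Or.inr k)
  · rcases m.opp_of_not_kept k with e | e | e
    · exact Or.inl e
    · exact Or.inr (Or.inl e)
    · rw [G.opp_opp] at e
      exact absurd h e.1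

/-- An outlet that does not lead outside could only be matched with the inlet, which is already
matched with a kept half-edge. -/
theorem MelonAt.kept_opp_outlet (m : G.MelonAt a b) (h : G.Kept a b (G.opp (Sum.inl (G.rot a)))) :
    G.Kept a b (G.opp (Sum.inl (G.rot (G.rot (G.rot b))))) := by
  by_contra k
  rcases m.opp_of_not_kept k with e | e | e
  · rw [← e, G.opp_opp] at h
    exact not_kept_outlet h
  · exact G.opp_ne _ e
  · rw [G.opp_opp] at e
    exact e.2.2 rfl

theorem MelonAt.kept_opp_inlet (m : G.MelonAt a b)
    (h : G.Kept a b (G.opp (Sum.inl (G.rot (G.rot (G.rot b)))))) :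
    G.Kept a b (G.opp (Sum.inl (G.rot a))) := by
  by_contra k
  rcases m.opp_of_not_kept k with e | e | e
  · exact G.opp_ne _ e
  · rw [← e, G.opp_opp] at h
    exact not_kept_inlet h
  · rw [G.opp_opp] at e
    exact e.2.1 rfl

/-- Following an edge and then jumping over the melon is the pairing of the graph after removal.
This lemma and the next two give what a pairing needs: it stays among the kept half-edges, it is an
involution, and it reverses signs. -/
theorem MelonAt.kept_bypass_opp (m : G.MelonAt a b) {x : G.Half} (h : G.Kept a b x) :
    G.Kept a b (G.bypass a b (G.opp x)) := by
  rcases m.opp_of_kept h with e | e | e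
  · rw [e, bypass_inlet]
    apply m.kept_opp_outlet
    rwa [← e, G.opp_opp]
  · rw [e, m.bypass_outlet]
    apply m.kept_opp_inlet
    rwa [← e, G.opp_opp]
  · rwa [bypass_of_kept e]

theorem MelonAt.bypass_opp_bypass_opp (m : G.MelonAt a b) {x : G.Half} (h : G.Kept a b x) :
    G.bypass a b (G.opp (G.bypass a b (G.opp x))) = x := by
  rcases m.opp_of_kept h with e | e | e
  · rw [e, bypass_inlet, G.opp_opp, m.bypass_outlet, ← e, G.opp_opp]
  · rw [e, m.bypass_outlet, G.opp_opp, bypass_inlet, ← e, G.opp_opp]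
  · rw [bypass_of_kept e, G.opp_opp, bypass_of_kept h]

theorem MelonAt.sign_bypass (m : G.MelonAt a b) (x : G.Half) :
    G.sign (G.bypass a b x) = G.sign x := by
  have hb := m.pos_b
  have ha := m.pos
  by_cases h₁ : x = Sum.inl (G.rot a)
  · rw [h₁, bypass_inlet, sign_opp_eq]
    simp [sign, G.pos_rot, ha, hb]
  by_cases h₂ : x = Sum.inl (G.rot (G.rot (G.rot b)))
  · rw [h₂, m.bypass_outlet, sign_opp_eq]
    simp [sign, G.pos_rot, ha, hb]
  rw [bypass_of_ne h₁ h₂]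

end Melon

/-! ### Removal of a melon, as an embedding of the smaller graph -/

/-- `G'` is obtained from `G` by the removal of the melon at `a` and `b`, the half-edges of `G'`
being identified by `f` with half-edges of `G`. -/
structure Removal (G G' : MarkedMOGraph.{u}) (a b : G.D) (f : G'.D → G.D) : Prop where
  melon : G.MelonAt a b
  inj : Function.Injective f
  range : ∀ d, d ∈ Set.range f ↔ ¬ G.AtVertex a d ∧ ¬ G.AtVertex b d
  pos : ∀ d, G.pos (f d) = G'.pos d
  rot : ∀ d, G.rot (f d) = f (G'.rot d)
  opp : ∀ h, Sum.map f id (G'.opp h) = G.bypass a b (G.opp (Sum.map f id h))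

theorem MelonAt.exists_removal {G : MarkedMOGraph.{u}} {a b : G.D} (m : G.MelonAt a b) :
    ∃ (G' : MarkedMOGraph.{u}) (f : G'.D → G.D), Removal G G' a b f := by
  let K : G.D → Prop := fun d => ¬ G.AtVertex a d ∧ ¬ G.AtVertex b d
  have hK : ∀ d, K (G.rot d) ↔ K d := fun d => by simp only [K, atVertex_rot_iff]
  let v : {d // K d} ⊕ Bool → G.Half := Sum.map Subtype.val id
  have hv : Function.Injective v := Sum.map_injective.2 ⟨Subtype.val_injective, fun _ _ h => h⟩
  have kv : ∀ h, G.Kept a b (v h) := by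
    rintro (d | c)
    · exact d.2
    · trivial
  have vk : ∀ x, G.Kept a b x → ∃ h, v h = x := by
    rintro (d | c) h
    · exact ⟨Sum.inl ⟨d, h⟩, rfl⟩
    · exact ⟨Sum.inr c, rfl⟩
  -- The new pairing is `bypass` after `opp`, read on the subtype of kept half-edges through the
  -- injection `v`.
  choose o ho using fun h => vk _ (m.kept_bypass_opp (kv h))
  have sv : ∀ h, Sum.elim (fun d : {d // K d} => G.pos d.1) id h = G.sign (v h) := by
    rintro (d | c) <;> rfl
  have := G.finite
  refine ⟨{ D := {d // K d}
            finite := inferInstance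
            rot := G.rot.subtypePerm hK
            pos := fun d => G.pos d.1
            opp := o
            rot_four := fun d => Subtype.ext (by simp)
            rot_two_ne := fun d h => G.rot_two_ne d.1 (congrArg Subtype.val h)
            pos_rot := fun d => G.pos_rot d.1
            opp_opp := fun h => hv (by rw [ho, ho, m.bypass_opp_bypass_opp (kv h)])
            sign_opp := fun h => by
              rw [sv, sv, ho, m.sign_bypass, sign_opp_eq] }, Subtype.val, ?_⟩
  exact ⟨m, Subtype.val_injective, fun d => by simp [K], fun _ => rfl, fun _ => rfl, ho⟩

/-! ### Isomorphisms and their action on melons -/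

namespace Iso

variable {G K L : MarkedMOGraph.{u}}

/-- The action of an isomorphism on half-edges. -/
def half (φ : Iso G K) : G.Half → K.Half := Sum.map φ.toEquiv id

@[simp] theorem half_inl (φ : Iso G K) (d : G.D) :
    φ.half (Sum.inl d) = Sum.inl (φ.toEquiv d) := rfl

@[simp] theorem half_inr (φ : Iso G K) (c : Bool) : φ.half (Sum.inr c) = Sum.inr c := rfl

theorem opp_half (φ : Iso G K) (x : G.Half) : K.opp (φ.half x) = φ.half (G.opp x) := φ.map_opp x

theorem half_injective (φ : Iso G K) : Function.Injective φ.half :=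
  Sum.map_injective.2 ⟨φ.toEquiv.injective, fun _ _ h => h⟩

theorem sign_half (φ : Iso G K) (x : G.Half) : K.sign (φ.half x) = G.sign x := by
  rcases x with d | c
  · exact φ.map_pos d
  · rfl

/-- The identity isomorphism. -/
def refl (G : MarkedMOGraph.{u}) : Iso G G where
  toEquiv := Equiv.refl _
  map_pos _ := rfl
  map_rot _ := rfl
  map_opp h := by simp

/-- The inverse isomorphism. -/
def symm (φ : Iso G K) : Iso K G where
  toEquiv := φ.toEquiv.symm
  map_pos d := by rw [← φ.map_pos, Equiv.apply_symm_apply]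
  map_rot d := by
    apply φ.toEquiv.injective
    rw [← φ.map_rot]; simp
  map_opp h := by
    apply φ.half_injective
    rw [← opp_half]
    simp [half]

/-- The composition of isomorphisms. -/
def trans (φ : Iso G K) (ψ : Iso K L) : Iso G L where
  toEquiv := φ.toEquiv.trans ψ.toEquiv
  map_pos d := by simp [ψ.map_pos, φ.map_pos]
  map_rot d := by simp [ψ.map_rot, φ.map_rot]
  map_opp h := by
    have e : ∀ h : G.Half, Sum.map (φ.toEquiv.trans ψ.toEquiv) id h = ψ.half (φ.half h) := by
      rintro (d | c) <;> rfl
    rw [e, e, opp_half, opp_half]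

theorem half_half_symm (φ : Iso G K) (x : K.Half) : φ.half (φ.symm.half x) = x := by
  simp [half, symm]

theorem half_trans (φ : Iso G K) (ψ : Iso K L) (x : G.Half) :
    (φ.trans ψ).half x = ψ.half (φ.half x) := by
  rcases x with d | c <;> rfl

theorem atVertex_iff (φ : Iso G K) (a x : G.D) :
    K.AtVertex (φ.toEquiv a) (φ.toEquiv x) ↔ G.AtVertex a x := by
  simp [AtVertex, φ.map_rot]

theorem melonAt (φ : Iso G K) {a b : G.D} (m : G.MelonAt a b) :
    K.MelonAt (φ.toEquiv a) (φ.toEquiv b) where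
  pos := by rw [φ.map_pos, m.pos]
  ne := by rw [φ.atVertex_iff]; exact m.ne
  opp₁ := by rw [← half_inl, opp_half, m.opp₁, half_inl]
  opp₂ := by rw [φ.map_rot, ← half_inl, opp_half, m.opp₂]; simp [φ.map_rot]
  opp₃ := by rw [φ.map_rot, φ.map_rot, ← half_inl, opp_half, m.opp₃]; simp [φ.map_rot]

theorem bypass_half (φ : Iso G K) {a b : G.D} (m : G.MelonAt a b) (x : G.Half) :
    K.bypass (φ.toEquiv a) (φ.toEquiv b) (φ.half x) = φ.half (G.bypass a b x) := by
  have e₁ : Sum.inl (K.rot (φ.toEquiv a)) = φ.half (Sum.inl (G.rot a)) := by simp [φ.map_rot]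
  have e₂ : Sum.inl (K.rot (K.rot (K.rot (φ.toEquiv b)))) =
      φ.half (Sum.inl (G.rot (G.rot (G.rot b)))) := by simp [φ.map_rot]
  by_cases h₁ : x = Sum.inl (G.rot a)
  · rw [h₁, ← e₁, bypass_inlet, bypass_inlet, e₂, opp_half]
  by_cases h₂ : x = Sum.inl (G.rot (G.rot (G.rot b)))
  · rw [h₂, ← e₂, (φ.melonAt m).bypass_outlet, m.bypass_outlet, e₁, opp_half]
  rw [bypass_of_ne h₁ h₂, bypass_of_ne]
  · rw [e₁]; exact fun h => h₁ (φ.half_injective h)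
  · rw [e₂]; exact fun h => h₂ (φ.half_injective h)

end Iso

/-! ### Uniqueness of removals and of insertions -/

namespace Removal

variable {G G' : MarkedMOGraph.{u}} {a b : G.D} {f : G'.D → G.D}

theorem half_injective (r : Removal G G' a b f) :
    Function.Injective (Sum.map f id : G'.Half → G.Half) :=
  Sum.map_injective.2 ⟨r.inj, fun _ _ h => h⟩

theorem kept_half (r : Removal G G' a b f) (h : G'.Half) : G.Kept a b (Sum.map f id h) := by
  rcases h with d | c
  · exact (r.range _).1 ⟨d, rfl⟩
  · trivial

theorem exists_of_kept (r : Removal G G' a b f) {x : G.Half} (h : G.Kept a b x) :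
    ∃ y : G'.Half, Sum.map f id y = x := by
  rcases x with d | c
  · obtain ⟨e, rfl⟩ := (r.range d).2 h
    exact ⟨Sum.inl e, rfl⟩
  · exact ⟨Sum.inr c, rfl⟩

theorem sign_half (r : Removal G G' a b f) (h : G'.Half) :
    G.sign (Sum.map f id h) = G'.sign h := by
  rcases h with d | c
  · exact r.pos d
  · rfl

/-- If `x` faces the inlet, its partner in `G'` faces the outlet: `x` and `G'.opp x` are the two
halves of the merged edge. By `opp_half`, every other edge of `G'` is already an edge of `G`. -/
theorem opp_opp_inlet (r : Removal G G' a b f) {x : G'.Half}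
    (hx : G.opp (Sum.map f id x) = Sum.inl (G.rot a)) :
    G.opp (Sum.map f id (G'.opp x)) = Sum.inl (G.rot (G.rot (G.rot b))) := by
  rw [r.opp, hx, bypass_inlet, G.opp_opp]

theorem opp_half (r : Removal G G' a b f) {x : G'.Half}
    (hx : G.opp (Sum.map f id x) = Sum.inl (G.rot a)) {y : G'.Half} (h₁ : y ≠ x)
    (h₂ : y ≠ G'.opp x) : G.opp (Sum.map f id y) = Sum.map f id (G'.opp y) := by
  rw [r.opp, bypass_of_ne]
  · rw [← hx]
    exact fun h => h₁ (r.half_injective (G.opp_injective h))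
  · rw [← r.opp_opp_inlet hx]
    exact fun h => h₂ (r.half_injective (G.opp_injective h))

theorem sign_inlet (r : Removal G G' a b f) {x : G'.Half}
    (hx : G.opp (Sum.map f id x) = Sum.inl (G.rot a)) : G'.sign x = true := by
  have h := G.sign_opp_eq (Sum.map f id x)
  rw [hx, r.sign_half] at h
  simpa [sign, G.pos_rot, r.melon.pos] using h

/-- Isomorphic graphs remain isomorphic when corresponding melons are removed. -/
theorem unique (r : Removal G G' a b f) {K K' : MarkedMOGraph.{u}} {k l : K.D} {g : K'.D → K.D}
    (s : Removal K K' k l g) (ψ : Iso G K) (ha : ψ.toEquiv a = k) (hb : ψ.toEquiv b = l) :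
    ∃ φ : Iso G' K', ∀ h, Sum.map g id (φ.half h) = ψ.half (Sum.map f id h) := by
  subst ha hb
  have key : ∀ d : G'.D, ∃ d' : K'.D, g d' = ψ.toEquiv (f d) := fun d => by
    apply (s.range _).2
    rw [ψ.atVertex_iff, ψ.atVertex_iff]
    exact (r.range _).1 ⟨d, rfl⟩
  choose p hp using key
  have pinj : Function.Injective p := fun d d' h => by
    apply r.inj
    apply ψ.toEquiv.injective
    rw [← hp, ← hp, h]
  have psurj : Function.Surjective p := fun d' => by
    have h1 := (s.range _).1 ⟨d', rfl⟩
    obtain ⟨d, hd⟩ := ψ.toEquiv.surjective (g d')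
    rw [← hd, ψ.atVertex_iff, ψ.atVertex_iff] at h1
    obtain ⟨e, rfl⟩ := (r.range _).2 h1
    exact ⟨e, s.inj ((hp e).trans hd)⟩
  have hh : ∀ h : G'.Half, Sum.map g id (Sum.map p id h : K'.Half) =
      ψ.half (Sum.map f id h) := by
    rintro (d | c)
    · exact congrArg Sum.inl (hp d)
    · rfl
  refine ⟨⟨Equiv.ofBijective p ⟨pinj, psurj⟩, fun d => ?_, fun d => ?_, fun h => ?_⟩, hh⟩
  · change K'.pos (p d) = _
    rw [← s.pos, hp, ψ.map_pos, r.pos]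
  · change K'.rot (p d) = p _
    apply s.inj
    rw [← s.rot, hp, hp, ψ.map_rot, r.rot]
  · change K'.opp (Sum.map p id h) = Sum.map p id _
    apply s.half_injective
    rw [s.opp, hh, hh, r.opp, Iso.opp_half, ψ.bypass_half r.melon]

end Removal

/-- The half-edges around a vertex, numbered from a given one. -/
def aroundVertex (G : MarkedMOGraph.{u}) (a : G.D) : Fin 4 → G.D :=
  ![a, G.rot a, G.rot (G.rot a), G.rot (G.rot (G.rot a))]

theorem rot_aroundVertex (G : MarkedMOGraph.{u}) (a : G.D) (i : Fin 4) :
    G.rot (G.aroundVertex a i) = G.aroundVertex a (i + 1) := by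
  fin_cases i <;> simp [aroundVertex]

theorem aroundVertex_injective (G : MarkedMOGraph.{u}) (a : G.D) :
    Function.Injective (G.aroundVertex a) := by
  have h1 := G.rot_ne
  have h2 := G.rot_two_ne
  have h3 := G.rot_three_ne
  have h1' := fun d => (G.rot_ne d).symm
  have h2' := fun d => (G.rot_two_ne d).symm
  have h3' := fun d => (G.rot_three_ne d).symm
  intro i j h
  fin_cases i <;> fin_cases j <;> simp_all [aroundVertex]

theorem atVertex_iff_exists (G : MarkedMOGraph.{u}) (a x : G.D) :
    G.AtVertex a x ↔ ∃ i, G.aroundVertex a i = x := by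
  simp [AtVertex, aroundVertex, Fin.exists_fin_succ, eq_comm]

namespace Removal

variable {G G' : MarkedMOGraph.{u}} {a b : G.D} {f : G'.D → G.D}

/-- The half-edges of `G` are those of `G'` together with four at each end-vertex of the melon. Maps
out of `G` can thus be defined, and its half-edges counted, by these three cases. -/
theorem bijective (r : Removal G G' a b f) : Function.Bijective
    (Sum.elim f (Sum.elim (G.aroundVertex a) (G.aroundVertex b)) :
      G'.D ⊕ (Fin 4 ⊕ Fin 4) → G.D) := by
  have hf := fun d => (r.range _).1 ⟨d, rfl⟩
  have A := fun i => (G.atVertex_iff_exists a _).2 ⟨i, rfl⟩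
  have B := fun i => (G.atVertex_iff_exists b _).2 ⟨i, rfl⟩
  constructor
  · apply r.inj.sumElim
    · apply (G.aroundVertex_injective a).sumElim (G.aroundVertex_injective b)
      intro i j h
      exact r.melon.ne ((A i).trans (h ▸ (B j)).symm)
    · rintro d (i | i) h
      · exact (hf d).1 (h ▸ A i)
      · exact (hf d).2 (h ▸ B i)
  · intro x
    by_cases hx : ¬ G.AtVertex a x ∧ ¬ G.AtVertex b x
    · obtain ⟨d, rfl⟩ := (r.range _).2 hx
      exact ⟨Sum.inl d, rfl⟩
    · rw [not_and_or, not_not, not_not, atVertex_iff_exists, atVertex_iff_exists] at hx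
      rcases hx with ⟨i, rfl⟩ | ⟨i, rfl⟩
      · exact ⟨Sum.inr (Sum.inl i), rfl⟩
      · exact ⟨Sum.inr (Sum.inr i), rfl⟩

/-- To prove a property of all half-edges, it suffices to treat those which remain after the
removal of a melon and those of the melon. -/
theorem half_cases (r : Removal G G' a b f) {P : G.Half → Prop}
    (h : ∀ y, P (Sum.map f id y)) (ha : ∀ i, P (Sum.inl (G.aroundVertex a i)))
    (hb : ∀ i, P (Sum.inl (G.aroundVertex b i))) (x : G.Half) : P x := by
  rcases x with d | c
  · obtain ⟨y | i | i, rfl⟩ := r.bijective.2 d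
    · exact h (Sum.inl y)
    · exact ha i
    · exact hb i
  · exact h (Sum.inr c)

/-- Isomorphic graphs remain isomorphic when melons are inserted in corresponding edges. -/
theorem unique_insertion (r : Removal G G' a b f) {K K' : MarkedMOGraph.{u}} {k l : K.D}
    {g : K'.D → K.D} (s : Removal K K' k l g) (φ : Iso G' K') {x : G'.Half}
    (hx : G.opp (Sum.map f id x) = Sum.inl (G.rot a))
    (hx' : K.opp (Sum.map g id (φ.half x)) = Sum.inl (K.rot k)) :
    ∃ ψ : Iso G K, (∀ h, ψ.half (Sum.map f id h) = Sum.map g id (φ.half h)) ∧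
      ψ.toEquiv a = k ∧ ψ.toEquiv b = l := by
  let E := Equiv.ofBijective _ r.bijective
  let F := Equiv.ofBijective _ s.bijective
  -- Glue `φ` with the identification of the two pairs of vertices numbered from `a`, `b` and from
  -- `k`, `l`.
  let p : G.D ≃ K.D := E.symm.trans ((Equiv.sumCongr φ.toEquiv (Equiv.refl _)).trans F)
  have pf : ∀ d, p (f d) = g (φ.toEquiv d) := fun d => by
    have : f d = E (Sum.inl d) := rfl
    rw [this]; simp [p]; rfl
  have pa : ∀ i, p (G.aroundVertex a i) = K.aroundVertex k i := fun i => by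
    have : G.aroundVertex a i = E (Sum.inr (Sum.inl i)) := rfl
    rw [this]; simp [p]; rfl
  have pb : ∀ i, p (G.aroundVertex b i) = K.aroundVertex l i := fun i => by
    have : G.aroundVertex b i = E (Sum.inr (Sum.inr i)) := rfl
    rw [this]; simp [p]; rfl
  have pa0 : p a = k := pa 0
  have pb0 : p b = l := pb 0
  have pr : ∀ d, K.rot (p d) = p (G.rot d) := fun d => by
    obtain ⟨y | i | i, rfl⟩ := r.bijective.2 d
    · change K.rot (p (f y)) = p (G.rot (f y))
      rw [r.rot, pf, pf, s.rot, φ.map_rot]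
    · change K.rot (p (G.aroundVertex a i)) = p (G.rot (G.aroundVertex a i))
      rw [rot_aroundVertex, pa, pa, rot_aroundVertex]
    · change K.rot (p (G.aroundVertex b i)) = p (G.rot (G.aroundVertex b i))
      rw [rot_aroundVertex, pb, pb, rot_aroundVertex]
  have pp : ∀ d, K.pos (p d) = G.pos d := fun d => by
    obtain ⟨y | i | i, rfl⟩ := r.bijective.2 d
    · change K.pos (p (f y)) = G.pos (f y)
      rw [pf, s.pos, r.pos, φ.map_pos]
    · change K.pos (p (G.aroundVertex a i)) = G.pos (G.aroundVertex a i)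
      rw [pa]
      fin_cases i <;> simp [aroundVertex, pos_rot, s.melon.pos, r.melon.pos]
    · change K.pos (p (G.aroundVertex b i)) = G.pos (G.aroundVertex b i)
      rw [pb]
      fin_cases i <;> simp [aroundVertex, pos_rot, s.melon.pos_b, r.melon.pos_b]
  have ph : ∀ h : G'.Half, (Sum.map p id (Sum.map f id h : G.Half) : K.Half) =
      Sum.map g id (φ.half h) := by
    rintro (d | c)
    · exact congrArg Sum.inl (pf d)
    · rfl
  have hy := r.opp_opp_inlet hx
  have hy' := s.opp_opp_inlet hx'
  have main : ∀ h : G.Half, K.opp (Sum.map p id h) = Sum.map p id (G.opp h) := by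
    -- Compatibility at one half of an edge gives it at the other, so one half suffices for each of
    -- the five edges at the melon (three internal, two external).
    have sy : ∀ h : G.Half, K.opp (Sum.map p id h) = Sum.map p id (G.opp h) →
        K.opp (Sum.map p id (G.opp h)) = Sum.map p id (G.opp (G.opp h)) := fun h e => by
      rw [← e, K.opp_opp, G.opp_opp]
    have A1 := r.melon.opp₁
    have A2 := r.melon.opp₂
    have A3 := r.melon.opp₃
    have B1 := s.melon.opp₁
    have B2 := s.melon.opp₂
    have B3 := s.melon.opp₃
    have c1 : K.opp (Sum.map p id (Sum.inl a : G.Half)) =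
        Sum.map p id (G.opp (Sum.inl a)) := by
      simp [A1, pa0, pb0, B1]
    have c2 : K.opp (Sum.map p id (Sum.inl (G.rot b) : G.Half)) =
        Sum.map p id (G.opp (Sum.inl (G.rot b))) := by
      simp [A2, ← pr, pa0, pb0, B2]
    have c3 : K.opp (Sum.map p id (Sum.inl (G.rot (G.rot a)) : G.Half)) =
        Sum.map p id (G.opp (Sum.inl (G.rot (G.rot a)))) := by
      simp [A3, ← pr, pa0, pb0, B3]
    have c4 : K.opp (Sum.map p id (Sum.map f id x : G.Half)) =
        Sum.map p id (G.opp (Sum.map f id x)) := by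
      rw [ph, hx', hx]; simp [← pr, pa0]
    have c5 : K.opp (Sum.map p id (Sum.map f id (G'.opp x) : G.Half)) =
        Sum.map p id (G.opp (Sum.map f id (G'.opp x))) := by
      rw [ph, ← φ.opp_half, hy', hy]; simp [← pr, pb0]
    refine r.half_cases (P := fun h => K.opp (Sum.map p id h) = Sum.map p id (G.opp h)) ?_ ?_ ?_
    · intro h
      by_cases h₁ : h = x
      · rw [h₁, c4]
      by_cases h₂ : h = G'.opp x
      · rw [h₂, c5]
      rw [r.opp_half hx h₁ h₂, ph, ph, ← φ.opp_half, s.opp_half hx']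
      · exact fun e => h₁ (φ.half_injective e)
      · rw [φ.opp_half]; exact fun e => h₂ (φ.half_injective e)
    · intro i
      fin_cases i
      · exact c1
      · have := sy _ c4; rwa [hx] at this
      · exact c3
      · have := sy _ c2; rwa [A2] at this
    · intro i
      fin_cases i
      · have := sy _ c1; rwa [A1] at this
      · exact c2
      · have := sy _ c3; rwa [A3] at this
      · have := sy _ c5; rwa [hy] at this
  exact ⟨⟨p, pp, pr, main⟩, ph, pa0, pb0⟩

end Removal

/-! ### Connectedness under removal and insertion -/

theorem eqvGen_induction {α : Type*} {r : α → α → Prop} {P : α → Prop}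
    (h : ∀ x y, r x y → (P x ↔ P y)) {x y : α} (e : Relation.EqvGen r x y) : P x ↔ P y := by
  induction e with
  | rel x y e => exact h x y e
  | refl x => rfl
  | symm x y _ ih => exact ih.symm
  | trans x y z _ _ ih₁ ih₂ => exact ih₁.trans ih₂

theorem kept_next_iff (G : MarkedMOGraph.{u}) (a b : G.D) (x : G.Half) :
    G.Kept a b (G.next x) ↔ G.Kept a b x := by
  rcases x with d | c
  · simp [Kept, next, atVertex_rot_iff]
  · simp [Kept, next]

/-- In a connected graph, a melon is not a connected component by itself. -/
theorem MelonAt.kept_of_connected {G : MarkedMOGraph.{u}} {a b : G.D} (m : G.MelonAt a b)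
    (hG : G.Connected) : G.Kept a b (G.opp (Sum.inl (G.rot a))) := by
  by_contra k
  have h := m.opp_of_not_kept k
  rw [G.opp_opp] at h
  have e : G.opp (Sum.inl (G.rot a)) = Sum.inl (G.rot (G.rot (G.rot b))) := by
    rcases h with h | h | h
    · exact absurd h (G.opp_ne _)
    · exact h
    · exact absurd rfl h.2.1
  -- With the inlet matched to the outlet, no edge leaves the melon, so being kept is constant on
  -- connected components. The root half-edges are kept and the inlet is not, which contradicts
  -- connectedness.
  have no : ∀ x, ¬ G.Kept a b x → ¬ G.Kept a b (G.opp x) := by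
    intro x hx
    rcases m.opp_of_not_kept hx with h | h | h
    · rw [h]; exact k
    · rw [h, ← e, G.opp_opp]; exact not_kept_inlet
    · exact h.1
  have := (eqvGen_induction (P := G.Kept a b) (r := G.Adj) ?_
    (hG (Sum.inr true) (Sum.inl (G.rot a)))).1 trivial
  · exact not_kept_inlet this
  · rintro x y (rfl | rfl)
    · refine ⟨fun h => ?_, fun h => ?_⟩
      · by_contra h'
        have := no _ h'
        rw [G.opp_opp] at this
        exact this h
      · by_contra h'
        exact no _ h' h
    · exact (G.kept_next_iff a b x).symm

namespace Removal

variable {G G' : MarkedMOGraph.{u}} {a b : G.D} {f : G'.D → G.D}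

/-- Connectedness ensures that the melon is attached to the rest of the graph, so that some edge of
`G'` really comes from merging its two external edges. -/
theorem exists_inlet (r : Removal G G' a b f) (hG : G.Connected) :
    ∃ x : G'.Half, G.opp (Sum.map f id x) = Sum.inl (G.rot a) := by
  obtain ⟨x, hx⟩ := r.exists_of_kept (r.melon.kept_of_connected hG)
  exact ⟨x, by rw [hx, G.opp_opp]⟩

theorem next_half (r : Removal G G' a b f) (h : G'.Half) :
    G.next (Sum.map f id h) = Sum.map f id (G'.next h) := by
  rcases h with d | c
  · exact congrArg Sum.inl (r.rot d)
  · rfl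

theorem connected (r : Removal G G' a b f) (hG : G.Connected) : G'.Connected := by
  classical
  obtain ⟨x, hx⟩ := r.exists_inlet hG
  -- A retraction onto `G'` that collapses the whole melon to the half-edge facing its inlet. It
  -- sends adjacent half-edges to connected ones, so paths of `G` project to `G'`.
  let c : G.Half → G'.Half := fun z =>
    if h : G.Kept a b z then (r.exists_of_kept h).choose else x
  have c1 : ∀ h, c (Sum.map f id h) = h := fun h => by
    have k := r.kept_half h
    simp only [c, dif_pos k]
    exact r.half_injective (r.exists_of_kept k).choose_spec
  have c2 : ∀ z, ¬ G.Kept a b z → c z = x := fun z k => dif_neg k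
  have hy := r.opp_opp_inlet hx
  have main : ∀ z w, G.Adj z w → Relation.EqvGen G'.Adj (c z) (c w) := by
    have o : ∀ h : G'.Half, Relation.EqvGen G'.Adj (c (Sum.map f id h))
        (c (G.opp (Sum.map f id h))) := by
      intro h
      by_cases h₁ : h = x
      · rw [h₁, hx, c1, c2 _ not_kept_inlet]
        exact Relation.EqvGen.refl _
      by_cases h₂ : h = G'.opp x
      · rw [h₂, hy, c1, c2 _ not_kept_outlet]
        exact (G'.eqvGen_opp x).symm
      rw [r.opp_half hx h₁ h₂, c1, c1]
      exact G'.eqvGen_opp h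
    rintro z w (rfl | rfl)
    · by_cases k : G.Kept a b z
      · obtain ⟨h, rfl⟩ := r.exists_of_kept k
        exact o h
      by_cases k' : G.Kept a b (G.opp z)
      · obtain ⟨h, hh⟩ := r.exists_of_kept k'
        have := o h
        rw [hh, G.opp_opp] at this
        exact this.symm
      · rw [c2 _ k, c2 _ k']
        exact Relation.EqvGen.refl _
    · by_cases k : G.Kept a b z
      · obtain ⟨h, rfl⟩ := r.exists_of_kept k
        rw [r.next_half, c1, c1]
        exact Relation.EqvGen.rel _ _ (Or.inr rfl)
      · rw [c2 _ k, c2 _ (mt (G.kept_next_iff a b z).1 k)]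
        exact Relation.EqvGen.refl _
  intro y z
  have : ∀ u w, Relation.EqvGen G.Adj u w → Relation.EqvGen G'.Adj (c u) (c w) := by
    intro u w e
    induction e with
    | rel x y e => exact main x y e
    | refl x => exact Relation.EqvGen.refl _
    | symm x y _ ih => exact ih.symm
    | trans x y z _ _ ih₁ ih₂ => exact ih₁.trans _ _ _ ih₂
  have e := this _ _ (hG (Sum.map f id y) (Sum.map f id z))
  rwa [c1, c1] at e

/-- The only edge of `G'` that is cut in `G` is the merged one, and its two halves remain connected
through the melon. The hypothesis on `x` rules out a melon that forms a component by itself. -/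
theorem connected_insertion (r : Removal G G' a b f) {x : G'.Half}
    (hx : G.opp (Sum.map f id x) = Sum.inl (G.rot a)) (hG : G'.Connected) : G.Connected := by
  have hy := r.opp_opp_inlet hx
  have ro : ∀ d, Relation.EqvGen G.Adj (Sum.inl d) (Sum.inl (G.rot d)) :=
    fun d => Relation.EqvGen.rel _ _ (Or.inr rfl)
  have A : ∀ i, Relation.EqvGen G.Adj (Sum.inl a) (Sum.inl (G.aroundVertex a i)) := by
    intro i
    fin_cases i
    · exact Relation.EqvGen.refl _
    · exact ro _
    · exact (ro _).trans _ _ _ (ro _)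
    · exact ((ro _).trans _ _ _ (ro _)).trans _ _ _ (ro _)
  have B : ∀ i, Relation.EqvGen G.Adj (Sum.inl a) (Sum.inl (G.aroundVertex b i)) := by
    have h := G.eqvGen_opp (Sum.inl a)
    rw [r.melon.opp₁] at h
    intro i
    refine h.trans _ _ _ ?_
    fin_cases i
    · exact Relation.EqvGen.refl _
    · exact ro _
    · exact (ro _).trans _ _ _ (ro _)
    · exact ((ro _).trans _ _ _ (ro _)).trans _ _ _ (ro _)
  have X : Relation.EqvGen G.Adj (Sum.inl a) (Sum.map f id x) := by
    refine (A 1).trans _ _ _ ?_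
    have h := (G.eqvGen_opp (Sum.map f id x)).symm
    rwa [hx] at h
  have Y : Relation.EqvGen G.Adj (Sum.inl a) (Sum.map f id (G'.opp x)) := by
    refine (B 3).trans _ _ _ ?_
    have h := (G.eqvGen_opp (Sum.map f id (G'.opp x))).symm
    rwa [hy] at h
  have key : ∀ u w, Relation.EqvGen G'.Adj u w →
      Relation.EqvGen G.Adj (Sum.map f id u) (Sum.map f id w) := by
    intro u w e
    induction e with
    | rel u w e =>
      rcases e with rfl | rfl
      · by_cases h₁ : u = x
        · rw [h₁]; exact X.symm.trans _ _ _ Y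
        by_cases h₂ : u = G'.opp x
        · rw [h₂, G'.opp_opp]; exact Y.symm.trans _ _ _ X
        rw [← r.opp_half hx h₁ h₂]
        exact G.eqvGen_opp _
      · rw [← r.next_half]
        exact Relation.EqvGen.rel _ _ (Or.inr rfl)
    | refl x => exact Relation.EqvGen.refl _
    | symm x y _ ih => exact ih.symm
    | trans x y z _ _ ih₁ ih₂ => exact ih₁.trans _ _ _ ih₂
  have all : ∀ z, Relation.EqvGen G.Adj (Sum.inl a) z :=
    r.half_cases (fun y => X.trans _ _ _ (key _ _ (hG x y))) A B
  exact fun z w => (all z).symm.trans _ _ _ (all w)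

end Removal

/-! ### Construction of the insertion of a melon -/

open Classical in
/-- The pairing of the half-edges when a melon is inserted in the edge of the half-edge `x`. -/
noncomputable def insertOpp (G : MarkedMOGraph.{u}) (x : G.Half) :
    (G.D ⊕ ULift.{u} (Bool × Fin 4)) ⊕ Bool → (G.D ⊕ ULift.{u} (Bool × Fin 4)) ⊕ Bool := fun h =>
  -- The new half-edges `⟨false, i⟩` and `⟨true, i⟩` are the `i`-th rotations of the future `a` and
  -- `b`. Hence `⟨false, 1⟩` is the inlet, attached to `x`, and `⟨true, 3⟩` is the outlet, attached
  -- to `G.opp x`.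
  let old : G.Half → (G.D ⊕ ULift.{u} (Bool × Fin 4)) ⊕ Bool := fun h =>
    if h = x then Sum.inl (Sum.inr ⟨false, 1⟩)
    else if h = G.opp x then Sum.inl (Sum.inr ⟨true, 3⟩)
    else Sum.map Sum.inl id (G.opp h)
  match h with
  | Sum.inr c => old (Sum.inr c)
  | Sum.inl (Sum.inl d) => old (Sum.inl d)
  | Sum.inl (Sum.inr ⟨false, 0⟩) => Sum.inl (Sum.inr ⟨true, 0⟩)
  | Sum.inl (Sum.inr ⟨false, 1⟩) => Sum.map Sum.inl id x
  | Sum.inl (Sum.inr ⟨false, 2⟩) => Sum.inl (Sum.inr ⟨true, 2⟩)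
  | Sum.inl (Sum.inr ⟨false, 3⟩) => Sum.inl (Sum.inr ⟨true, 1⟩)
  | Sum.inl (Sum.inr ⟨true, 0⟩) => Sum.inl (Sum.inr ⟨false, 0⟩)
  | Sum.inl (Sum.inr ⟨true, 1⟩) => Sum.inl (Sum.inr ⟨false, 3⟩)
  | Sum.inl (Sum.inr ⟨true, 2⟩) => Sum.inl (Sum.inr ⟨false, 2⟩)
  | Sum.inl (Sum.inr ⟨true, 3⟩) => Sum.map Sum.inl id (G.opp x)

section

variable (G : MarkedMOGraph.{u}) (x : G.Half)

theorem insertOpp_same :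
    G.insertOpp x (Sum.map Sum.inl id x) = Sum.inl (Sum.inr ⟨false, 1⟩) := by
  rcases x with d | c <;> simp [insertOpp]

theorem insertOpp_opp :
    G.insertOpp x (Sum.map Sum.inl id (G.opp x)) = Sum.inl (Sum.inr ⟨true, 3⟩) := by
  have h := G.opp_ne x
  rcases hy : G.opp x with d | c <;> rw [hy] at h <;> simp [insertOpp, h, hy]

theorem insertOpp_of_ne {h : G.Half} (h₁ : h ≠ x) (h₂ : h ≠ G.opp x) :
    G.insertOpp x (Sum.map Sum.inl id h) = Sum.map Sum.inl id (G.opp h) := by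
  rcases h with d | c <;> simp [insertOpp, h₁, h₂]

/-- The sign of the half-edges of an inserted melon. -/
def insertPos : Bool × Fin 4 → Bool := fun p => xor p.1 (p.2.val % 2 == 0)

theorem insert_cases {P : (G.D ⊕ ULift.{u} (Bool × Fin 4)) ⊕ Bool → Prop}
    (h : ∀ y : G.Half, P (Sum.map Sum.inl id y)) (h' : ∀ s i, P (Sum.inl (Sum.inr ⟨s, i⟩))) :
    ∀ z, P z := by
  rintro ((d | ⟨s, i⟩) | c)
  · exact h (Sum.inl d)
  · exact h' s i
  · exact h (Sum.inr c)

theorem insertOpp_insertOpp (z) : G.insertOpp x (G.insertOpp x z) = z := by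
  revert z
  apply insert_cases
  · intro y
    by_cases h₁ : y = x
    · rw [h₁, insertOpp_same]; rfl
    by_cases h₂ : y = G.opp x
    · rw [h₂, insertOpp_opp]; rfl
    rw [insertOpp_of_ne _ _ h₁ h₂, insertOpp_of_ne, G.opp_opp]
    · exact fun h => h₂ ((G.opp_eq_iff _ _).1 h)
    · exact fun h => h₁ (G.opp_injective h)
  · intro s i
    cases s <;> fin_cases i <;> first | rfl | exact G.insertOpp_same x | exact G.insertOpp_opp x

/-- The inlet is negative and the outlet positive, which is why the half-edge `x` joined to the
inlet has to be the positive half of its edge. -/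
theorem sign_insertOpp (hx : G.sign x = true) (z) :
    Sum.elim (Sum.elim G.pos fun p => insertPos p.down) id (G.insertOpp x z) =
      !(Sum.elim (Sum.elim G.pos fun p => insertPos p.down) id z) := by
  have e : ∀ y : G.Half, Sum.elim (Sum.elim G.pos fun p : ULift.{u} (Bool × Fin 4) =>
      insertPos p.down) id (Sum.map Sum.inl id y) = G.sign y := by
    rintro (d | c) <;> rfl
  revert z
  apply insert_cases
  · intro y
    by_cases h₁ : y = x
    · rw [h₁, insertOpp_same, e, hx]; rfl
    by_cases h₂ : y = G.opp x
    · rw [h₂, insertOpp_opp, e, sign_opp_eq, hx]; rfl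
    rw [insertOpp_of_ne _ _ h₁ h₂, e, e, sign_opp_eq]
  · intro s i
    cases s <;> fin_cases i <;>
      first
      | rfl
      | exact (e x).trans hx
      | exact (e (G.opp x)).trans (by rw [sign_opp_eq, hx]; rfl)

/-- The graph obtained by inserting a melon in the edge whose positive half is `x`. -/
noncomputable def insert (hx : G.sign x = true) : MarkedMOGraph.{u} where
  D := G.D ⊕ ULift.{u} (Bool × Fin 4)
  finite := by
    have := G.finite
    infer_instance
  rot := Equiv.sumCongr G.rot (Equiv.ulift.trans
    ((Equiv.prodCongr (Equiv.refl Bool) (Equiv.addRight 1)).trans Equiv.ulift.symm))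
  pos := Sum.elim G.pos fun p => insertPos p.down
  opp := G.insertOpp x
  rot_four := by
    rintro (d | ⟨s, i⟩)
    · simp
    · cases s <;> fin_cases i <;> rfl
  rot_two_ne := by
    rintro (d | ⟨s, i⟩)
    · simpa using G.rot_two_ne d
    · intro h
      have h2 := congrArg Prod.snd (congrArg ULift.down (Sum.inr.inj h))
      exact (by decide : ∀ i : Fin 4, i + 1 + 1 ≠ i) i h2
  pos_rot := by
    rintro (d | ⟨s, i⟩)
    · exact G.pos_rot d
    · cases s <;> fin_cases i <;> rfl
  opp_opp := G.insertOpp_insertOpp x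
  sign_opp := G.sign_insertOpp x hx

theorem removal_insert (hx : G.sign x = true) :
    Removal (G.insert x hx) G (Sum.inr ⟨false, 0⟩) (Sum.inr ⟨true, 0⟩) Sum.inl where
  melon :=
    { pos := rfl
      ne := by
        rintro (h | h | h | h) <;>
          exact absurd (congrArg Prod.fst (congrArg ULift.down (Sum.inr.inj h))) (by decide)
      opp₁ := rfl
      opp₂ := rfl
      opp₃ := rfl }
  inj := Sum.inl_injective
  range := by
    rintro (d | ⟨s, i⟩)
    · refine ⟨fun _ => ?_, fun _ => ⟨d, rfl⟩⟩
      constructor <;> rintro (h | h | h | h) <;> cases h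
    · refine ⟨fun ⟨d, h⟩ => (nomatch h), fun ⟨h₁, h₂⟩ => ?_⟩
      exfalso
      cases s <;> fin_cases i
      · exact h₁ (Or.inl rfl)
      · exact h₁ (Or.inr (Or.inl rfl))
      · exact h₁ (Or.inr (Or.inr (Or.inl rfl)))
      · exact h₁ (Or.inr (Or.inr (Or.inr rfl)))
      · exact h₂ (Or.inl rfl)
      · exact h₂ (Or.inr (Or.inl rfl))
      · exact h₂ (Or.inr (Or.inr (Or.inl rfl)))
      · exact h₂ (Or.inr (Or.inr (Or.inr rfl)))
  pos _ := rfl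
  rot _ := rfl
  opp h := by
    have si : Function.Injective (Sum.map Sum.inl id : G.Half → (G.insert x hx).Half) :=
      Sum.map_injective.2 ⟨Sum.inl_injective, fun _ _ h => h⟩
    change _ = (G.insert x hx).bypass _ _ (G.insertOpp x (Sum.map Sum.inl id h))
    by_cases h₁ : h = x
    · rw [h₁, insertOpp_same]
      exact (bypass_inlet (G := G.insert x hx) (a := Sum.inr ⟨false, 0⟩)
        (b := Sum.inr ⟨true, 0⟩)).symm
    by_cases h₂ : h = G.opp x
    · rw [h₂, insertOpp_opp, G.opp_opp]
      symm
      refine (if_neg ?_).trans (if_pos rfl)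
      intro h
      exact absurd (congrArg Prod.fst (congrArg ULift.down (Sum.inr.inj (Sum.inl.inj h))))
        (by decide)
    rw [insertOpp_of_ne _ _ h₁ h₂]
    symm
    apply bypass_of_ne
    · rcases G.opp h with d | c <;> intro h <;> cases h
    · rcases G.opp h with d | c <;> intro h <;> cases h

theorem opp_insert (hx : G.sign x = true) : (G.insert x hx).opp (Sum.map Sum.inl id x) =
    Sum.inl ((G.insert x hx).rot (Sum.inr ⟨false, 0⟩)) :=
  G.insertOpp_same x

end

/-! ### Melons and their local description -/

theorem turn_turn (G : MarkedMOGraph.{u}) (t : StrandType) (h : G.Half) :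
    G.turn t (G.turn t h) = h := by
  rcases h with d | c
  · cases t
    · exact G.turn_left_turn_left _
    · by_cases hd : G.pos d = true
      · simp [turn, hd, G.pos_rot]
      · simp [turn, hd, pos_rot_symm]
    · simp [turn]
  · simp [turn]

theorem mem_faceThrough_self (G : MarkedMOGraph.{u}) (t : StrandType) (h : G.Half) :
    h ∈ G.faceThrough t h := Relation.EqvGen.refl _

theorem opp_mem_faceThrough {G : MarkedMOGraph.{u}} {t : StrandType} {h x : G.Half}
    (hx : x ∈ G.faceThrough t h) : G.opp x ∈ G.faceThrough t h :=
  Relation.EqvGen.trans _ _ _ hx (Relation.EqvGen.rel _ _ (Or.inl rfl))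

theorem turn_mem_faceThrough {G : MarkedMOGraph.{u}} {t : StrandType} {h x : G.Half}
    (hx : x ∈ G.faceThrough t h) : G.turn t x ∈ G.faceThrough t h :=
  Relation.EqvGen.trans _ _ _ hx (Relation.EqvGen.rel _ _ (Or.inr rfl))

/-- A face of length `2` is given by four half-edges. -/
theorem faceThrough_eq {G : MarkedMOGraph.{u}} {t : StrandType} {p q r s : G.Half}
    (h₁ : G.opp p = q) (h₂ : G.turn t q = r) (h₃ : G.opp r = s) (h₄ : G.turn t p = s) :
    G.faceThrough t p = {p, q, r, s} := by
  subst h₁ h₂ h₃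
  have e : G.turn t (G.opp (G.turn t (G.opp p))) = p := by rw [← h₄, turn_turn]
  apply Set.Subset.antisymm
  · intro x hx
    have key := eqvGen_induction (r := G.StrandAdj t)
      (P := fun x => x ∈ ({p, G.opp p, G.turn t (G.opp p), G.opp (G.turn t (G.opp p))} :
        Set G.Half)) ?_ hx
    · exact key.1 (Or.inl rfl)
    · have o : ∀ x, x ∈ ({p, G.opp p, G.turn t (G.opp p), G.opp (G.turn t (G.opp p))} :
          Set G.Half) → G.opp x ∈ ({p, G.opp p, G.turn t (G.opp p),
            G.opp (G.turn t (G.opp p))} : Set G.Half) := by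
        rintro x (rfl | rfl | rfl | rfl) <;> simp [G.opp_opp]
      have u : ∀ x, x ∈ ({p, G.opp p, G.turn t (G.opp p), G.opp (G.turn t (G.opp p))} :
          Set G.Half) → G.turn t x ∈ ({p, G.opp p, G.turn t (G.opp p),
            G.opp (G.turn t (G.opp p))} : Set G.Half) := by
        rintro x (rfl | rfl | rfl | rfl)
        · rw [h₄]; simp
        · simp
        · rw [turn_turn]; simp
        · rw [e]; simp
      rintro x y (rfl | rfl)
      · exact ⟨o x, fun h => by have := o _ h; rwa [G.opp_opp] at this⟩
      · exact ⟨u x, fun h => by have := u _ h; rwa [turn_turn] at this⟩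
  · have m := G.mem_faceThrough_self t p
    have m2 := opp_mem_faceThrough m
    have m3 := turn_mem_faceThrough m2
    rintro x (rfl | rfl | rfl | rfl)
    · exact m
    · exact m2
    · exact m3
    · exact opp_mem_faceThrough m3

theorem MelonAt.isMelon {G : MarkedMOGraph.{u}} {a b : G.D} (m : G.MelonAt a b) :
    ∃ e₁ e₂ e₃ : G.Edge, G.IsMelon e₁ e₂ e₃ ∧ e₁.1 = Sum.inl a ∧ e₂.1 = Sum.inl (G.rot b) := by
  have h1 := m.opp₁
  have h2 := m.opp₂
  have h3 := m.opp₃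
  have pa := m.pos
  have pb := m.pos_b
  have na : ∀ {x}, G.AtVertex a x → ¬ G.AtVertex b x := fun h h' => m.ne (h.trans h'.symm)
  have A := G.atVertex_self a
  have B := G.atVertex_self b
  refine ⟨⟨Sum.inl a, pa⟩, ⟨Sum.inl (G.rot b), ?_⟩, ⟨Sum.inl (G.rot (G.rot a)), ?_⟩, ?_, rfl, rfl⟩
  · simp [sign, G.pos_rot, pb]
  · simp [sign, G.pos_rot, pa]
  constructor
  · simp [MeetsRoot, h1]
  · simp [MeetsRoot, h2]
  · simp [MeetsRoot, h3]
  · refine ⟨fun h => ?_, ?_⟩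
    · exact na A ((Sum.inl.inj (congrArg Subtype.val h)) ▸ B.rot)
    · apply faceThrough_eq rfl
      · change G.turn .left (G.opp (Sum.inl a)) = _
        rw [h1]; simp [turn, pb]
      · rfl
      · change _ = G.opp (Sum.inl (G.rot b))
        rw [h2]; simp [turn, pa, rot_symm_eq]
  · refine ⟨fun h => ?_, ?_⟩
    · exact na A.rot.rot ((Sum.inl.inj (congrArg Subtype.val h)) ▸ B.rot)
    · apply faceThrough_eq rfl
      · change G.turn .right (G.opp (Sum.inl (G.rot b))) = _
        rw [h2]; simp [turn, pa, G.pos_rot]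
      · rfl
      · change _ = G.opp (Sum.inl (G.rot (G.rot a)))
        rw [h3]; simp [turn, pb, G.pos_rot]
  · refine ⟨fun h => ?_, ?_⟩
    · exact G.rot_two_ne a (Sum.inl.inj (congrArg Subtype.val h)).symm
    · refine (faceThrough_eq (s := Sum.inl (G.rot (G.rot a))) rfl rfl ?_ rfl).trans ?_
      · change G.opp (G.turn .straight (G.opp (Sum.inl a))) = _
        rw [h1, opp_eq_iff, h3]; rfl
      · have : G.turn .straight (G.opp (Sum.inl a)) = G.opp (Sum.inl (G.rot (G.rot a))) := by
          rw [h1, h3]; rfl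
        rw [this, Set.pair_comm (G.opp (Sum.inl (G.rot (G.rot a))))]

/-- The hypothesis `ht` holds for external strands. The turn of `e.1` then has negative sign, so it
is `G.opp e.1` or `G.opp f.1`; in the first case the face would close up along `e` alone and miss
`f`. -/
theorem FormFace.turn_eq {G : MarkedMOGraph.{u}} {t : StrandType} {e f : G.Edge}
    (ht : ∀ h, G.sign (G.turn t h) = !G.sign h) (h : G.FormFace t e f) :
    G.turn t e.1 = G.opp f.1 ∧ G.turn t (G.opp e.1) = f.1 := by
  have he := e.2
  have hf := f.2
  have m := G.mem_faceThrough_self t e.1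
  have m2 := turn_mem_faceThrough m
  have m3 := turn_mem_faceThrough (opp_mem_faceThrough m)
  rw [h.2] at m2 m3
  have s2 := ht e.1
  have s3 := ht (G.opp e.1)
  rw [he] at s2
  rw [sign_opp_eq, he] at s3
  have no : G.turn t e.1 ≠ G.opp e.1 := by
    intro k
    have hfm : f.1 ∈ G.faceThrough t e.1 := by rw [h.2]; simp
    have key := (eqvGen_induction (r := G.StrandAdj t)
      (P := fun x => x = e.1 ∨ x = G.opp e.1) ?_ hfm).1 (Or.inl rfl)
    · rcases key with k' | k'
      · exact h.1 (Subtype.ext k').symm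
      · rw [k', sign_opp_eq, he] at hf; cases hf
    · have k2 : G.turn t (G.opp e.1) = e.1 := by rw [← k, turn_turn]
      have o : ∀ x, x = e.1 ∨ x = G.opp e.1 → G.opp x = e.1 ∨ G.opp x = G.opp e.1 := by
        rintro x (rfl | rfl) <;> simp [G.opp_opp]
      have u : ∀ x, x = e.1 ∨ x = G.opp e.1 → G.turn t x = e.1 ∨ G.turn t x = G.opp e.1 := by
        rintro x (rfl | rfl) <;> simp [k, k2]
      rintro x y (rfl | rfl)
      · exact ⟨o x, fun h => by have := o _ h; rwa [G.opp_opp] at this⟩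
      · exact ⟨u x, fun h => by have := u _ h; rwa [turn_turn] at this⟩
  constructor
  · rcases m2 with k | k | k | k
    · rw [k, he] at s2; cases s2
    · exact absurd k no
    · rw [k, hf] at s2; cases s2
    · exact k
  · rcases m3 with k | k | k | k
    · exact absurd ((congrArg (G.turn t) k).symm.trans (G.turn_turn t _)) no
    · rw [k, sign_opp_eq, he] at s3; cases s3
    · exact k
    · rw [k, sign_opp_eq, hf] at s3; cases s3

/-- The left face locates the halves of `e₂` next to those of `e₁`, and the straight face places the
halves of `e₃` opposite to them, with signs selecting the only possible position. The end-vertices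
differ, since otherwise either the signs would clash or `e₂` would coincide with `e₁` or `e₃`. -/
theorem IsMelon.melonAt {G : MarkedMOGraph.{u}} {e₁ e₂ e₃ : G.Edge} (m : G.IsMelon e₁ e₂ e₃) :
    ∃ a b, G.MelonAt a b ∧ e₁.1 = Sum.inl a ∧ e₂.1 = Sum.inl (G.rot b) := by
  have he₁ := e₁.2
  have he₃ := e₃.2
  have r := m.root₁
  obtain ⟨a, ha⟩ : ∃ a, e₁.1 = Sum.inl a := by
    rcases h : e₁.1 with d | c
    · exact ⟨d, rfl⟩
    · exact absurd (Or.inl (by rw [h]; rfl)) r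
  obtain ⟨b, hb⟩ : ∃ b, G.opp e₁.1 = Sum.inl b := by
    rcases h : G.opp e₁.1 with d | c
    · exact ⟨d, rfl⟩
    · exact absurd (Or.inr (by rw [h]; rfl)) r
  have pa : G.pos a = true := by rw [ha] at he₁; exact he₁
  have pb : G.pos b = false := by
    have := G.sign_opp_eq e₁.1
    rw [hb, he₁] at this
    exact this
  obtain ⟨l₁, l₂⟩ := m.left.turn_eq G.sign_turn_left
  rw [ha] at l₁
  rw [hb] at l₂
  simp only [turn, pa, pb, if_true, rot_symm_eq, Bool.false_eq_true, if_false] at l₁ l₂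
  have m2 : G.turn .straight e₁.1 = e₃.1 := by
    have h := turn_mem_faceThrough (G.mem_faceThrough_self .straight e₁.1)
    rw [m.straight.2, hb, ha] at h
    rw [ha]
    rcases h with h | h | h | h
    · exact absurd (Sum.inl.inj h) (G.rot_two_ne a)
    · have := congrArg G.pos (Sum.inl.inj h)
      simp [pos_rot, pa, pb] at this
    · exact h
    · have := congrArg G.sign h
      rw [sign_opp_eq, he₃] at this
      simp [turn, sign, pos_rot, pa] at this
  have m3 : G.turn .straight (G.opp e₁.1) = G.opp e₃.1 := by
    have h := turn_mem_faceThrough (opp_mem_faceThrough (G.mem_faceThrough_self .straight e₁.1))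
    rw [m.straight.2, hb, ha] at h
    rw [hb]
    rcases h with h | h | h | h
    · have := congrArg G.pos (Sum.inl.inj h)
      simp [pos_rot, pa, pb] at this
    · exact absurd (Sum.inl.inj h) (G.rot_two_ne b)
    · have := congrArg G.sign h
      rw [he₃] at this
      simp [turn, sign, pos_rot, pb] at this
    · exact h
  rw [ha] at m2
  rw [hb] at m3
  simp only [turn] at m2 m3
  refine ⟨a, b, ⟨pa, ?_, by rw [← ha, hb], by rw [l₂, l₁], by rw [m2, m3]⟩, ha, l₂.symm⟩
  rintro (h | h | h | h)
  · rw [h, pa] at pb; cases pb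
  · apply m.right.1
    apply Subtype.ext
    rw [← l₂, ← m2, h]
  · rw [h] at pb; simp [pos_rot, pa] at pb
  · apply m.left.1
    apply Subtype.ext
    rw [← l₂, ha, h, G.rot_four]

theorem not_melonFree_iff (G : MarkedMOGraph.{u}) : ¬ G.MelonFree ↔ ∃ a b, G.MelonAt a b := by
  constructor
  · intro h
    simp only [MelonFree, not_forall, not_not] at h
    obtain ⟨e₁, e₂, e₃, m⟩ := h
    obtain ⟨a, b, m, -⟩ := m.melonAt
    exact ⟨a, b, m⟩
  · rintro ⟨a, b, m⟩ h
    obtain ⟨e₁, e₂, e₃, m, -⟩ := m.isMelon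
    exact h _ _ _ m

theorem sameVertex_inl_iff {G : MarkedMOGraph.{u}} (a : G.D) (x : G.D) :
    G.SameVertex (Sum.inl a) (Sum.inl x) ↔ G.AtVertex a x := by
  constructor
  · intro h
    have := (eqvGen_induction (r := fun p q => q = G.next p)
      (P := Sum.elim (G.AtVertex a) fun _ => False) ?_ h).1 (G.atVertex_self a)
    · exact this
    · rintro (d | c) y rfl
      · exact (G.atVertex_rot_iff a d).symm
      · exact Iff.rfl
  · have ro : ∀ d, G.SameVertex (Sum.inl d) (Sum.inl (G.rot d)) :=
      fun d => Relation.EqvGen.rel _ _ rfl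
    rintro (rfl | rfl | rfl | rfl)
    · exact Relation.EqvGen.refl _
    · exact ro _
    · exact (ro _).trans _ _ _ (ro _)
    · exact ((ro _).trans _ _ _ (ro _)).trans _ _ _ (ro _)

/-- The definition of a removal describes each edge of `G'` from its positive half, by two
alternatives. Here this is replaced by the single formula with `bypass`, valid for all half-edges.
-/
theorem isMelonRemoval_iff (G G' : MarkedMOGraph.{u}) :
    G.IsMelonRemoval G' ↔ ∃ a b f, Removal G G' a b f := by
  constructor
  · rintro ⟨e₁, e₂, e₃, m, f, finj, frange, fpos, frot, fopp⟩
    obtain ⟨a, b, m, h₁, h₂⟩ := m.melonAt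
    rw [h₁, m.opp₁] at frange
    have frange' : ∀ d, d ∈ Set.range f ↔ ¬ G.AtVertex a d ∧ ¬ G.AtVertex b d := fun d => by
      rw [frange, sameVertex_inl_iff, sameVertex_inl_iff]
    have kf : ∀ h : G'.Half, G.Kept a b (Sum.map f id h) := by
      rintro (d | c)
      · exact (frange' _).1 ⟨d, rfl⟩
      · trivial
    refine ⟨a, b, f, m, finj, frange', fpos, frot, ?_⟩
    rw [h₂, m.opp₂] at fopp
    simp only [turn, rot_four] at fopp
    have key : ∀ e : G'.Edge,
        Sum.map f id (G'.opp e.1) = G.bypass a b (G.opp (Sum.map f id e.1)) ∧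
        Sum.map f id e.1 = G.bypass a b (G.opp (Sum.map f id (G'.opp e.1))) := by
      intro e
      rcases fopp e with h | ⟨h, h'⟩
      · rw [h, bypass_of_kept (kf _), ← h, G.opp_opp, bypass_of_kept (kf _)]
        exact ⟨rfl, rfl⟩
      · rw [h, bypass_inlet, ← h', G.opp_opp, m.bypass_outlet, ← h, G.opp_opp]
        exact ⟨rfl, rfl⟩
    intro h
    by_cases hs : G'.sign h = true
    · exact (key ⟨h, hs⟩).1
    · have := (key ⟨G'.opp h, by rw [sign_opp_eq]; simpa using hs⟩).2
      simpa [G'.opp_opp] using this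
  · rintro ⟨a, b, f, r⟩
    have m := r.melon
    obtain ⟨e₁, e₂, e₃, m', h₁, h₂⟩ := m.isMelon
    refine ⟨e₁, e₂, e₃, m', f, r.inj, fun d => ?_, r.pos, r.rot, fun e => ?_⟩
    · rw [r.range, h₁, m.opp₁, sameVertex_inl_iff, sameVertex_inl_iff]
    · rw [h₂, m.opp₂]
      simp only [turn, rot_four]
      have he := e.2
      rw [r.opp]
      by_cases k₁ : G.opp (Sum.map f id e.1) = Sum.inl (G.rot a)
      · right
        rw [k₁, bypass_inlet]
        exact ⟨rfl, rfl⟩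
      · left
        rw [bypass_of_ne k₁]
        -- The partner of a positive half is negative, whereas the outlet is positive.
        intro k
        have := congrArg G.sign k
        rw [sign_opp_eq, r.sign_half, he] at this
        simp [sign, pos_rot, m.pos_b] at this

/-! ### Invariance of the degree -/

/-- A counting device for classes: `c` labels each element of `X` by an old class or by a new one in
`T`, and `g` and `z` provide representatives. It is applied to faces, with one new class, and to
vertices, with two. -/
theorem card_quot_eq_add {X Y T : Type*} [Finite Y] [Finite T] {r : X → X → Prop}
    {r' : Y → Y → Prop} (g : Y → X) (c : X → Quot r' ⊕ T) (z : T → X)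
    (h₁ : ∀ y y', r' y y' → Quot.mk r (g y) = Quot.mk r (g y'))
    (h₂ : ∀ x x', r x x' → c x = c x') (h₃ : ∀ y, c (g y) = Sum.inl (Quot.mk _ y))
    (h₄ : ∀ t, c (z t) = Sum.inr t) (h₅ : ∀ x t, c x = Sum.inr t → Quot.mk r x = Quot.mk r (z t))
    (h₆ : ∀ x q, c x = Sum.inl q → ∃ y, Quot.mk r x = Quot.mk r (g y)) :
    Nat.card (Quot r) = Nat.card (Quot r') + Nat.card T := by
  have : Finite (Quot r') := Finite.of_surjective _ Quot.mk_surjective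
  rw [← Nat.card_sum]
  refine Nat.card_congr
    { toFun := Quot.lift c h₂
      invFun := Sum.elim (Quot.lift (fun y => Quot.mk r (g y)) h₁) fun t => Quot.mk r (z t)
      left_inv := ?_
      right_inv := ?_ }
  · rintro ⟨x⟩
    change Sum.elim _ _ (c x) = Quot.mk r x
    rcases h : c x with q | t
    · obtain ⟨y, hy⟩ := h₆ x q h
      have e : c x = c (g y) := congrArg (Quot.lift c h₂) hy
      rw [h₃, h] at e
      rw [e, hy]
      rfl
    · exact (h₅ x t h).symm
  · rintro (q | t)
    · obtain ⟨y, rfl⟩ := Quot.exists_rep q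
      exact h₃ y
    · exact h₄ t

theorem quot_mk_opp (G : MarkedMOGraph.{u}) (t : StrandType) (h : G.Half) :
    Quot.mk (G.StrandAdj t) (G.opp h) = Quot.mk _ h :=
  (Quot.sound (r := G.StrandAdj t) (Or.inl rfl)).symm

theorem quot_mk_turn (G : MarkedMOGraph.{u}) (t : StrandType) (h : G.Half) :
    Quot.mk (G.StrandAdj t) (G.turn t h) = Quot.mk _ h :=
  (Quot.sound (r := G.StrandAdj t) (Or.inr rfl)).symm

/-- Strands at a vertex are determined by rotation and signs alone, so this applies both to
isomorphisms and to the embedding given by a removal, although the latter does not preserve edges.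
-/
theorem turn_half_of_rot {G G' : MarkedMOGraph.{u}} {f : G'.D → G.D}
    (hpos : ∀ d, G.pos (f d) = G'.pos d) (hrot : ∀ d, G.rot (f d) = f (G'.rot d))
    (t : StrandType) (h : G'.Half) :
    G.turn t (Sum.map f id h) = Sum.map f id (G'.turn t h) := by
  rcases h with d | c
  · by_cases hd : G'.pos d = true <;> cases t <;>
      simp [turn, hpos, hd, hrot, rot_symm_eq]
  · cases t <;> rfl

namespace Removal

variable {G G' : MarkedMOGraph.{u}} {a b : G.D} {f : G'.D → G.D}

theorem exists_extension (r : Removal G G' a b f) {α : Type*} (F : G'.Half → α)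
    (A B : Fin 4 → α) : ∃ c : G.Half → α, (∀ h, c (Sum.map f id h) = F h) ∧
      (∀ i, c (Sum.inl (G.aroundVertex a i)) = A i) ∧
      ∀ i, c (Sum.inl (G.aroundVertex b i)) = B i := by
  let E := Equiv.ofBijective _ r.bijective
  refine ⟨Sum.elim (fun d => Sum.elim (fun y => F (Sum.inl y)) (Sum.elim A B) (E.symm d))
    fun s => F (Sum.inr s), ?_, fun i => ?_, fun i => ?_⟩
  · rintro (d | s)
    · have : f d = E (Sum.inl d) := rfl
      simp [this]
    · rfl
  · have : G.aroundVertex a i = E (Sum.inr (Sum.inl i)) := rfl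
    simp [this]
  · have : G.aroundVertex b i = E (Sum.inr (Sum.inr i)) := rfl
    simp [this]

theorem turn_half (r : Removal G G' a b f) (t : StrandType) (h : G'.Half) :
    G.turn t (Sum.map f id h) = Sum.map f id (G'.turn t h) :=
  turn_half_of_rot r.pos r.rot t h

/-- The number of faces of a given type drops by one when a melon is removed; `A` and `B` tell
which half-edges of the melon are on the face that goes through the melon. -/
theorem numFacesOf_eq_of_table (r : Removal G G' a b f) {x : G'.Half}
    (hx : G.opp (Sum.map f id x) = Sum.inl (G.rot a)) (t : StrandType) (A B : Fin 4 → Bool)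
    (τ σ : Fin 4 → Fin 4) (z : Fin 4)
    (hτ : ∀ i, G.turn t (Sum.inl (G.aroundVertex a i)) = Sum.inl (G.aroundVertex a (τ i)))
    (hσ : ∀ i, G.turn t (Sum.inl (G.aroundVertex b i)) = Sum.inl (G.aroundVertex b (σ i)))
    (hA : ∀ i, A (τ i) = A i) (hB : ∀ i, B (σ i) = B i)
    (h₀ : A 0 = B 0) (h₁ : A 3 = B 1) (h₂ : A 2 = B 2) (h₃ : A 1 = true) (h₄ : B 3 = true)
    (hz : A z = false)
    (cA : ∀ i, Quot.mk (G.StrandAdj t) (Sum.inl (G.aroundVertex a i)) =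
      Quot.mk _ (if A i then Sum.map f id x else Sum.inl (G.aroundVertex a z)))
    (cB : ∀ i, Quot.mk (G.StrandAdj t) (Sum.inl (G.aroundVertex b i)) =
      Quot.mk _ (if B i then Sum.map f id x else Sum.inl (G.aroundVertex a z))) :
    G.numFacesOf t = G'.numFacesOf t + 1 := by
  -- Half-edges on the strand crossing the melon belong to the face of the merged edge; the
  -- remaining ones form the face that disappears.
  let V : Bool → Quot (G'.StrandAdj t) ⊕ Unit :=
    fun s => if s then Sum.inl (Quot.mk _ x) else Sum.inr ()
  obtain ⟨c, cF, ca, cb⟩ := r.exists_extension (α := Quot (G'.StrandAdj t) ⊕ Unit)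
    (fun h => Sum.inl (Quot.mk _ h)) (fun i => V (A i)) (fun i => V (B i))
  have := G'.finite
  have hy := r.opp_opp_inlet hx
  have qo := G'.quot_mk_opp t
  have qt := G'.quot_mk_turn t
  have Qo := G.quot_mk_opp t
  have Qt := G.quot_mk_turn t
  have a1 : c (Sum.inl (G.rot a)) = V (A 1) := ca 1
  have b3 : c (Sum.inl (G.rot (G.rot (G.rot b)))) = V (B 3) := cb 3
  have sy : ∀ {h}, c h = c (G.opp h) → c (G.opp h) = c (G.opp (G.opp h)) := fun h => by
    rw [G.opp_opp]; exact h.symm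
  have e1 : c (Sum.map f id x) = c (G.opp (Sum.map f id x)) := by
    rw [hx, cF, a1, h₃]; rfl
  have e2 : c (Sum.map f id (G'.opp x)) = c (G.opp (Sum.map f id (G'.opp x))) := by
    rw [hy, cF, b3, h₄, qo]; rfl
  have e3 : c (Sum.inl a) = c (G.opp (Sum.inl a)) := by
    rw [r.melon.opp₁]; exact (ca 0).trans ((congrArg V h₀).trans (cb 0).symm)
  have e4 : c (Sum.inl (G.rot b)) = c (G.opp (Sum.inl (G.rot b))) := by
    rw [r.melon.opp₂]; exact (cb 1).trans ((congrArg V h₁).symm.trans (ca 3).symm)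
  have e5 : c (Sum.inl (G.rot (G.rot a))) = c (G.opp (Sum.inl (G.rot (G.rot a)))) := by
    rw [r.melon.opp₃]; exact (ca 2).trans ((congrArg V h₂).trans (cb 2).symm)
  have oc : ∀ w, c w = c (G.opp w) := by
    refine r.half_cases (P := fun w => c w = c (G.opp w)) (fun h => ?_) (fun i => ?_) fun i => ?_
    · by_cases k₁ : h = x
      · rw [k₁, e1]
      by_cases k₂ : h = G'.opp x
      · rw [k₂, e2]
      rw [r.opp_half hx k₁ k₂, cF, cF, qo]
    · fin_cases i
      · exact e3
      · have := sy e1; rwa [hx] at this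
      · exact e5
      · have := sy e4; rwa [r.melon.opp₂] at this
    · fin_cases i
      · have := sy e3; rwa [r.melon.opp₁] at this
      · exact e4
      · have := sy e5; rwa [r.melon.opp₃] at this
      · have := sy e2; rwa [hy] at this
  have tc : ∀ w, c w = c (G.turn t w) := by
    refine r.half_cases (P := fun w => c w = c (G.turn t w)) (fun h => ?_) (fun i => ?_)
      fun i => ?_
    · rw [r.turn_half, cF, cF, qt]
    · rw [hτ, ca, ca, hA]
    · rw [hσ, cb, cb, hB]
  have := card_quot_eq_add (r := G.StrandAdj t) (r' := G'.StrandAdj t) (Sum.map f id) c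
    (fun _ => Sum.inl (G.aroundVertex a z)) ?_ ?_ cF ?_ ?_ ?_
  · simpa [numFacesOf] using this
  -- The two halves of the merged edge stay on one face in `G`, because the crossing strand leads
  -- from the inlet to the outlet.
  · have q1 : Quot.mk (G.StrandAdj t) (Sum.map f id (G'.opp x)) =
        Quot.mk _ (Sum.map f id x) := by
      rw [← Qo, hy]
      have := cB 3
      rw [h₄] at this
      exact this
    rintro y y' (rfl | rfl)
    · by_cases k₁ : y = x
      · rw [k₁, q1]
      by_cases k₂ : y = G'.opp x
      · rw [k₂, G'.opp_opp, q1]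
      rw [← r.opp_half hx k₁ k₂, Qo]
    · rw [← r.turn_half, Qt]
  · rintro w w' (rfl | rfl)
    · exact oc w
    · exact tc w
  · intro s
    rw [ca, hz]; rfl
  · refine r.half_cases (P := fun w => ∀ s, c w = Sum.inr s → Quot.mk (G.StrandAdj t) w =
      Quot.mk _ (Sum.inl (G.aroundVertex a z))) (fun h s e => ?_) (fun i s e => ?_)
      fun i s e => ?_
    · rw [cF] at e; cases e
    · rw [ca] at e
      rw [cA]
      cases k : A i
      · rfl
      · rw [k] at e; cases e
    · rw [cb] at e
      rw [cB]
      cases k : B i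
      · rfl
      · rw [k] at e; cases e
  · refine r.half_cases (P := fun w => ∀ q, c w = Sum.inl q → ∃ y,
      Quot.mk (G.StrandAdj t) w = Quot.mk _ (Sum.map f id y)) (fun h q e => ⟨h, rfl⟩)
      (fun i q e => ⟨x, ?_⟩) fun i q e => ⟨x, ?_⟩
    · rw [ca] at e
      rw [cA]
      cases k : A i
      · rw [k] at e; cases e
      · rfl
    · rw [cb] at e
      rw [cB]
      cases k : B i
      · rw [k] at e; cases e
      · rfl

/-- In each table, `false` marks the face of length two formed by two edges of the melon, and `true`
the strand from inlet to outlet, which follows the remaining edge: the third for left strands, the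
first for right ones, the second for straight ones. The permutations are the turns at the two
vertices, numbered from `a` and `b`. -/
theorem numFacesOf_eq (r : Removal G G' a b f) {x : G'.Half}
    (hx : G.opp (Sum.map f id x) = Sum.inl (G.rot a)) (t : StrandType) :
    G.numFacesOf t = G'.numFacesOf t + 1 := by
  have pa := r.melon.pos
  have pb := r.melon.pos_b
  have Qo := G.quot_mk_opp t
  have Qt := G.quot_mk_turn t
  have o1 := Qo (Sum.inl a)
  have o2 := Qo (Sum.inl (G.rot b))
  have o3 := Qo (Sum.inl (G.rot (G.rot a)))
  have ox := Qo (Sum.map f id x)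
  rw [r.melon.opp₁] at o1
  rw [r.melon.opp₂] at o2
  rw [r.melon.opp₃] at o3
  rw [hx] at ox
  have t0 := Qt (Sum.inl a)
  have t1 := Qt (Sum.inl (G.rot a))
  have t2 := Qt (Sum.inl (G.rot (G.rot a)))
  have t3 := Qt (Sum.inl (G.rot (G.rot (G.rot a))))
  have s0 := Qt (Sum.inl b)
  have s1 := Qt (Sum.inl (G.rot b))
  have s2 := Qt (Sum.inl (G.rot (G.rot b)))
  have s3 := Qt (Sum.inl (G.rot (G.rot (G.rot b))))
  cases t
  · refine r.numFacesOf_eq_of_table hx .left ![false, true, true, false]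
      ![false, false, true, true] ![3, 2, 1, 0] ![1, 0, 3, 2] 0 ?_ ?_ (by decide) (by decide)
      rfl rfl rfl rfl rfl rfl ?_ ?_
    · intro i; fin_cases i <;> simp [turn, aroundVertex, pos_rot, pa, rot_symm_eq]
    · intro i; fin_cases i <;> simp [turn, aroundVertex, pos_rot, pb]
    all_goals
      simp only [turn, pos_rot, pa, pb, rot_symm_eq, rot_four, Bool.not_true, Bool.not_false,
        Bool.false_eq_true, if_true, if_false] at t0 t1 t2 t3 s0 s1 s2 s3
      intro i; fin_cases i <;> simp [aroundVertex] <;> grind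
  · refine r.numFacesOf_eq_of_table hx .right ![true, true, false, false]
      ![true, false, false, true] ![1, 0, 3, 2] ![3, 2, 1, 0] 2 ?_ ?_ (by decide) (by decide)
      rfl rfl rfl rfl rfl rfl ?_ ?_
    · intro i; fin_cases i <;> simp [turn, aroundVertex, pos_rot, pa]
    · intro i; fin_cases i <;> simp [turn, aroundVertex, pos_rot, pb, rot_symm_eq]
    all_goals
      simp only [turn, pos_rot, pa, pb, rot_symm_eq, rot_four, Bool.not_true, Bool.not_false,
        Bool.false_eq_true, if_true, if_false] at t0 t1 t2 t3 s0 s1 s2 s3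
      intro i; fin_cases i <;> simp [aroundVertex] <;> grind
  · refine r.numFacesOf_eq_of_table hx .straight ![false, true, false, true]
      ![false, true, false, true] ![2, 3, 0, 1] ![2, 3, 0, 1] 0 ?_ ?_ (by decide) (by decide)
      rfl rfl rfl rfl rfl rfl ?_ ?_
    · intro i; fin_cases i <;> simp [turn, aroundVertex]
    · intro i; fin_cases i <;> simp [turn, aroundVertex]
    all_goals
      simp only [turn, rot_four] at t0 t1 t2 t3 s0 s1 s2 s3
      intro i; fin_cases i <;> simp [aroundVertex] <;> grind

theorem numVertices_eq (r : Removal G G' a b f) : G.numVertices = G'.numVertices + 2 := by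
  let E := Equiv.ofBijective _ r.bijective
  let q : G'.D → Quot fun x y : G'.D => y = G'.rot x := Quot.mk _
  let c : G.D → (Quot fun x y : G'.D => y = G'.rot x) ⊕ Bool := fun d =>
    Sum.elim (fun y => Sum.inl (q y))
      (Sum.elim (fun _ => Sum.inr true) fun _ => Sum.inr false) (E.symm d)
  have cf : ∀ y, c (f y) = Sum.inl (q y) := fun y => by
    have : f y = E (Sum.inl y) := rfl
    simp [c, this]
  have ca : ∀ i, c (G.aroundVertex a i) = Sum.inr true := fun i => by
    have : G.aroundVertex a i = E (Sum.inr (Sum.inl i)) := rfl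
    simp [c, this]
  have cb : ∀ i, c (G.aroundVertex b i) = Sum.inr false := fun i => by
    have : G.aroundVertex b i = E (Sum.inr (Sum.inr i)) := rfl
    simp [c, this]
  have cases' : ∀ {P : G.D → Prop}, (∀ y, P (f y)) → (∀ i, P (G.aroundVertex a i)) →
      (∀ i, P (G.aroundVertex b i)) → ∀ d, P d := fun h₁ h₂ h₃ d => by
    obtain ⟨y | i | i, rfl⟩ := r.bijective.2 d
    · exact h₁ y
    · exact h₂ i
    · exact h₃ i
  have Qr : ∀ d : G.D, Quot.mk (fun x y : G.D => y = G.rot x) (G.rot d) = Quot.mk _ d :=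
    fun d => (Quot.sound (r := fun x y : G.D => y = G.rot x) rfl).symm
  have Qv : ∀ d i, Quot.mk (fun x y : G.D => y = G.rot x) (G.aroundVertex d i) =
      Quot.mk _ d := by
    intro d i
    fin_cases i
    · rfl
    · exact Qr d
    · exact (Qr _).trans (Qr d)
    · exact (Qr _).trans ((Qr _).trans (Qr d))
  have := G'.finite
  have := card_quot_eq_add (r := fun x y : G.D => y = G.rot x)
    (r' := fun x y : G'.D => y = G'.rot x) f c (fun s => if s then a else b) ?_ ?_ cf ?_ ?_ ?_
  · simpa [numVertices] using this
  · rintro y _ rfl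
    rw [← r.rot, Qr]
  · rintro d _ rfl
    revert d
    apply cases'
    · intro y
      rw [r.rot, cf, cf]
      exact congrArg Sum.inl (Quot.sound rfl)
    · intro i
      rw [rot_aroundVertex, ca, ca]
    · intro i
      rw [rot_aroundVertex, cb, cb]
  · rintro (s | s)
    · exact cb 0
    · exact ca 0
  · refine cases' (P := fun d => ∀ t, c d = Sum.inr t → Quot.mk _ d =
      Quot.mk _ (if t then a else b)) (fun y t e => ?_) (fun i t e => ?_) fun i t e => ?_
    · rw [cf] at e; cases e
    · rw [ca] at e; cases e; exact Qv a i
    · rw [cb] at e; cases e; exact Qv b i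
  · refine cases' (P := fun d => ∀ s, c d = Sum.inl s → ∃ y, Quot.mk _ d =
      Quot.mk _ (f y)) (fun y t e => ⟨y, rfl⟩) (fun i t e => ?_) fun i t e => ?_
    · rw [ca] at e; cases e
    · rw [cb] at e; cases e

end Removal

theorem Connected.numComponents {G : MarkedMOGraph.{u}} (hG : G.Connected) :
    G.numComponents = 1 := by
  rw [MarkedMOGraph.numComponents, Nat.card_eq_one_iff_unique]
  refine ⟨⟨?_⟩, ⟨Quot.mk _ (Sum.inr true)⟩⟩
  rintro ⟨x⟩ ⟨y⟩
  exact Quot.eqvGen_sound (hG x y)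

theorem Removal.degree_eq {G G' : MarkedMOGraph.{u}} {a b : G.D} {f : G'.D → G.D}
    (r : Removal G G' a b f) (hG : G.Connected) : G.degree = G'.degree := by
  obtain ⟨x, hx⟩ := r.exists_inlet hG
  rw [degree, degree, numFaces, numFaces, r.numFacesOf_eq hx, r.numFacesOf_eq hx,
    r.numFacesOf_eq hx, r.numVertices_eq, hG.numComponents, (r.connected hG).numComponents]
  push_cast
  ring

theorem Iso.degree_eq {G K : MarkedMOGraph.{u}} (φ : Iso G K) : G.degree = K.degree := by
  let ψ : G.Half ≃ K.Half := Equiv.sumCongr φ.toEquiv (Equiv.refl _)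
  have hψ : ∀ x, ψ x = φ.half x := by rintro (d | c) <;> rfl
  have o : ∀ x, K.opp (ψ x) = ψ (G.opp x) := fun x => by rw [hψ, hψ, φ.opp_half]
  have n : ∀ x, K.next (ψ x) = ψ (G.next x) := by
    rintro (d | c)
    · exact congrArg Sum.inl (φ.map_rot d)
    · rfl
  have t : ∀ t x, K.turn t (ψ x) = ψ (G.turn t x) := fun t x => by
    rw [hψ, hψ]
    exact turn_half_of_rot φ.map_pos φ.map_rot t x
  have h₁ : G.numComponents = K.numComponents :=
    Nat.card_congr (Quot.congr ψ fun x y => by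
      simp only [Adj, o, n, ψ.injective.eq_iff])
  have h₂ : G.numVertices = K.numVertices :=
    Nat.card_congr (Quot.congr φ.toEquiv fun x y => by
      simp only [φ.map_rot, φ.toEquiv.injective.eq_iff])
  have h₃ : ∀ t, G.numFacesOf t = K.numFacesOf t := fun s =>
    Nat.card_congr (Quot.congr ψ fun x y => by
      simp only [StrandAdj, o, t, ψ.injective.eq_iff])
  simp only [degree, numFaces, h₁, h₂, h₃]

/-! ### Confluence of the removals of melons -/

/-- A melon with outlet joined to inlet is a whole component. In the next lemmas, most ways in which
two melons could overlap force this configuration. -/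
theorem MelonAt.outlet_ne {G : MarkedMOGraph.{u}} {a b : G.D} (m : G.MelonAt a b)
    (hG : G.Connected) : G.opp (Sum.inl (G.rot (G.rot (G.rot b)))) ≠ Sum.inl (G.rot a) := by
  intro h
  have := m.kept_of_connected hG
  rw [← h, G.opp_opp] at this
  exact not_kept_outlet this

theorem MelonAt.opp_b {G : MarkedMOGraph.{u}} {a b : G.D} (m : G.MelonAt a b) :
    G.opp (Sum.inl b) = Sum.inl a := by
  rw [opp_eq_iff, m.opp₁]

/-- By signs, `c` could only be `a` or the half-edge opposite to it. In the latter case the second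
melon would start along the third edge of the first, and its own second edge would join outlet to
inlet. -/
theorem MelonAt.eq_or_not_atVertex {G : MarkedMOGraph.{u}} {a b c d : G.D}
    (m : G.MelonAt a b) (n : G.MelonAt c d) (hG : G.Connected) :
    a = c ∧ b = d ∨ ¬ G.AtVertex a c := by
  by_cases h : G.AtVertex a c
  · left
    have hc := n.pos
    rcases h with rfl | rfl | rfl | rfl
    · exact ⟨rfl, Sum.inl.inj (m.opp₁.symm.trans n.opp₁)⟩
    · simp [pos_rot, m.pos] at hc
    · exfalso
      have hd := n.opp₁
      rw [m.opp₃] at hd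
      obtain rfl := Sum.inl.inj hd
      have := n.opp₂
      rw [G.rot_four] at this
      exact m.outlet_ne hG this
    · simp [pos_rot, m.pos] at hc
  · exact Or.inr h

/-- By signs, `d` would be the inlet or the negative half of the second edge. If it is the inlet,
the third edge of the second melon is the second edge of the first, so the edge at the inlet would
stay inside the melon. Otherwise `c` is the positive half of the second edge and the third edge of
the other melon joins outlet to inlet. -/
theorem MelonAt.not_atVertex_cross {G : MarkedMOGraph.{u}} {a b c d : G.D}
    (m : G.MelonAt a b) (n : G.MelonAt c d) (hG : G.Connected) : ¬ G.AtVertex a d := by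
  intro h
  have hd := n.pos_b
  rcases h with rfl | rfl | rfl | rfl
  · rw [m.pos] at hd; cases hd
  · have k := m.kept_of_connected hG
    rw [n.opp_b] at k
    have h3 := n.opp₃
    rw [← m.opp₂] at h3
    have h4 := Sum.inl.inj (G.opp_injective h3)
    apply k.2
    rw [← atVertex_rot_iff, ← atVertex_rot_iff, h4]
    exact (G.atVertex_self b).rot
  · simp [pos_rot, m.pos] at hd
  · have h1 := n.opp_b
    rw [← m.opp₂, G.opp_opp] at h1
    obtain rfl := Sum.inl.inj h1
    have := n.opp₃
    rw [G.rot_four] at this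
    exact m.outlet_ne hG this

/-- Two distinct melons of a connected graph have no vertex in common. -/
theorem MelonAt.eq_or_disjoint {G : MarkedMOGraph.{u}} {a b c d : G.D}
    (m : G.MelonAt a b) (n : G.MelonAt c d) (hG : G.Connected) :
    a = c ∧ b = d ∨ (¬ G.AtVertex a c ∧ ¬ G.AtVertex b c) ∧
      (¬ G.AtVertex a d ∧ ¬ G.AtVertex b d) := by
  rcases m.eq_or_not_atVertex n hG with h | h
  · exact Or.inl h
  refine Or.inr ⟨⟨h, fun k => n.not_atVertex_cross m hG k.symm⟩, m.not_atVertex_cross n hG,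
    fun k => h ?_⟩
  have hd := n.pos_b
  rcases k with rfl | rfl | rfl | rfl
  · have := n.opp_b
    rw [m.opp_b] at this
    rw [Sum.inl.inj this]
    exact G.atVertex_self c
  · simp [pos_rot, m.pos_b] at hd
  · have := n.opp_b
    rw [← m.opp₃, G.opp_opp] at this
    rw [← Sum.inl.inj this]
    exact (G.atVertex_self a).rot.rot
  · simp [pos_rot, m.pos_b] at hd

/-- An edge may cross two melons in series, in either order. Both sides compute where it comes out.
The walk starts at `o x`, outside both melons, so it cannot run back into its starting point. -/
theorem jump_comm {α : Type*} [DecidableEq α] (o : α → α) (ho : ∀ x, o (o x) = x) {a b c d x : α}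
    (hab : a ≠ b) (hac : a ≠ c) (had : a ≠ d) (hbc : b ≠ c) (hbd : b ≠ d) (hcd : c ≠ d)
    (ha : o x ≠ a) (hb : o x ≠ b) (hc : o x ≠ c) (hd : o x ≠ d) (P Q : α → α)
    (hP : ∀ x, P x = if x = a then o b else if x = b then o a else x)
    (hQ : ∀ x, Q x = if x = c then o d else if x = d then o c else x) :
    (if P x = c then P (o d) else if P x = d then P (o c) else P x) =
      if Q x = a then Q (o b) else if Q x = b then Q (o a) else Q x := by
  grind

namespace Removal

variable {G G' : MarkedMOGraph.{u}} {a b : G.D} {f : G'.D → G.D}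

theorem atVertex_iff (r : Removal G G' a b f) (x y : G'.D) :
    G.AtVertex (f x) (f y) ↔ G'.AtVertex x y := by
  simp [AtVertex, r.rot, r.inj.eq_iff]

/-- An edge joining two kept half-edges meets neither inlet nor outlet, so removing the first melon
leaves the edges of the second one intact. -/
theorem melonAt_lift (r : Removal G G' a b f) {c d : G'.D} (m : G.MelonAt (f c) (f d)) :
    G'.MelonAt c d := by
  have key : ∀ x y : G'.D, G.opp (Sum.inl (f x)) = Sum.inl (f y) →
      G'.opp (Sum.inl x) = Sum.inl y := by
    intro x y h
    apply r.half_injective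
    rw [r.opp]
    change G.bypass a b (G.opp (Sum.inl (f x))) = Sum.inl (f y)
    rw [h]
    exact bypass_of_kept (r.kept_half (Sum.inl y))
  refine ⟨by rw [← r.pos, m.pos], fun h => m.ne ((r.atVertex_iff _ _).2 h),
    key _ _ m.opp₁, key _ _ ?_, key _ _ ?_⟩
  · simpa only [r.rot] using m.opp₂
  · simpa only [r.rot] using m.opp₃

open Classical in
theorem half_bypass (r : Removal G G' a b f) (c d : G'.D) (z : G'.Half) :
    Sum.map f id (G'.bypass c d z) =
      if Sum.map f id z = Sum.inl (G.rot (f c)) then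
        G.bypass a b (G.opp (Sum.inl (G.rot (G.rot (G.rot (f d))))))
      else if Sum.map f id z = Sum.inl (G.rot (G.rot (G.rot (f d)))) then
        G.bypass a b (G.opp (Sum.inl (G.rot (f c))))
      else Sum.map f id z := by
  have e₁ : Sum.inl (G.rot (f c)) = (Sum.map f id (Sum.inl (G'.rot c) : G'.Half) : G.Half) := by
    simp [r.rot]
  have e₂ : Sum.inl (G.rot (G.rot (G.rot (f d)))) =
      (Sum.map f id (Sum.inl (G'.rot (G'.rot (G'.rot d))) : G'.Half) : G.Half) := by
    simp [r.rot]
  rw [e₁, e₂, ← r.opp, ← r.opp]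
  simp only [r.half_injective.eq_iff, bypass]
  split_ifs <;> rfl

/-- The removals of two disjoint melons commute. -/
theorem diamond (r : Removal G G' a b f) {G₂ : MarkedMOGraph.{u}} {c d : G.D} {g : G₂.D → G.D}
    (s : Removal G G₂ c d g) (hc : ¬ G.AtVertex a c ∧ ¬ G.AtVertex b c)
    (hd : ¬ G.AtVertex a d ∧ ¬ G.AtVertex b d) :
    ∃ (G₃ : MarkedMOGraph.{u}) (c' d' : G'.D) (g' : G₃.D → G'.D) (a' b' : G₂.D)
      (f' : G₃.D → G₂.D), Removal G' G₃ c' d' g' ∧ Removal G₂ G₃ a' b' f' := by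
  obtain ⟨c', rfl⟩ := (r.range c).2 hc
  obtain ⟨d', rfl⟩ := (r.range d).2 hd
  obtain ⟨a', rfl⟩ := (s.range a).2 ⟨fun h => hc.1 h.symm, fun h => hd.1 h.symm⟩
  obtain ⟨b', rfl⟩ := (s.range b).2 ⟨fun h => hc.2 h.symm, fun h => hd.2 h.symm⟩
  obtain ⟨G₃, g', r'⟩ := (r.melonAt_lift s.melon).exists_removal
  -- Half-edges of `G₃` avoid all four vertices of the two melons, so they embed in `G₂` as well.
  have ex : ∀ y, ∃ z, g z = f (g' y) := fun y => by
    apply (s.range _).2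
    rw [r.atVertex_iff, r.atVertex_iff]
    exact (r'.range _).1 ⟨y, rfl⟩
  choose f' hf' using ex
  have hh : ∀ y : G₃.Half, (Sum.map g id (Sum.map f' id y : G₂.Half) : G.Half) =
      Sum.map f id (Sum.map g' id y : G'.Half) := by
    rintro (y | t)
    · exact congrArg Sum.inl (hf' y)
    · rfl
  refine ⟨G₃, c', d', g', a', b', f', r', s.melonAt_lift r.melon, fun y z h => ?_, fun z => ?_,
    fun y => ?_, fun y => ?_, fun y => ?_⟩
  · apply r'.inj
    apply r.inj
    rw [← hf', ← hf', h]
  · rw [← s.atVertex_iff, ← s.atVertex_iff]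
    constructor
    · rintro ⟨y, rfl⟩
      rw [hf']
      exact (r.range _).1 ⟨_, rfl⟩
    · intro h
      obtain ⟨w, hw⟩ := (r.range _).2 h
      have := (s.range _).1 ⟨z, rfl⟩
      rw [← hw, r.atVertex_iff, r.atVertex_iff] at this
      obtain ⟨y, rfl⟩ := (r'.range _).2 this
      exact ⟨y, s.inj (by rw [hf', hw])⟩
  · rw [← s.pos, hf', r.pos, r'.pos]
  · apply s.inj
    rw [← s.rot, hf', hf', r.rot, r'.rot]
  · apply s.half_injective
    rw [hh, r'.opp, r.half_bypass, s.half_bypass, r.opp, s.opp, hh]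
    have k₁ := r.kept_half (Sum.map g' id y)
    have k₂ := s.kept_half (Sum.map f' id y)
    rw [hh] at k₂
    have A := G.atVertex_self (g a')
    have B := G.atVertex_self (g b')
    have C := G.atVertex_self (f c')
    have D := G.atVertex_self (f d')
    classical
    refine jump_comm G.opp G.opp_opp (a := Sum.inl (G.rot (g a')))
      (b := Sum.inl (G.rot (G.rot (G.rot (g b'))))) (c := Sum.inl (G.rot (f c')))
      (d := Sum.inl (G.rot (G.rot (G.rot (f d'))))) ?_ ?_ ?_ ?_ ?_ ?_ ?_ ?_ ?_ ?_ (G.bypass (g a') (g b'))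
      (G.bypass (f c') (f d')) (fun _ => rfl) (fun _ => rfl)
    · exact fun h => r.melon.inlet_ne_outlet (Sum.inl.inj h)
    · exact fun h => hc.1 (A.rot.trans ((Sum.inl.inj h) ▸ C.rot.symm))
    · exact fun h => hd.1 (A.rot.trans ((Sum.inl.inj h) ▸ D.rot.rot.rot.symm))
    · exact fun h => hc.2 (B.rot.rot.rot.trans ((Sum.inl.inj h) ▸ C.rot.symm))
    · exact fun h => hd.2 (B.rot.rot.rot.trans ((Sum.inl.inj h) ▸ D.rot.rot.rot.symm))
    · exact fun h => s.melon.inlet_ne_outlet (Sum.inl.inj h)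
    all_goals rw [G.opp_opp]; intro h; rw [h] at k₁ k₂
    · exact k₁.1 A.rot
    · exact k₁.2 B.rot.rot.rot
    · exact k₂.1 C.rot
    · exact k₂.2 D.rot.rot.rot

theorem comp_iso (r : Removal G G' a b f) {K : MarkedMOGraph.{u}} (φ : Iso G K) :
    Removal K G' (φ.toEquiv a) (φ.toEquiv b) fun d => φ.toEquiv (f d) where
  melon := φ.melonAt r.melon
  inj := φ.toEquiv.injective.comp r.inj
  range d := by
    obtain ⟨d, rfl⟩ := φ.toEquiv.surjective d
    rw [φ.atVertex_iff, φ.atVertex_iff, ← r.range]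
    simp
  pos d := by rw [φ.map_pos, r.pos]
  rot d := by rw [φ.map_rot, r.rot]
  opp h := by
    have e : ∀ h : G'.Half, Sum.map (fun d => φ.toEquiv (f d)) id h =
        φ.half (Sum.map f id h) := by rintro (d | c) <;> rfl
    rw [e, e, r.opp, φ.opp_half, φ.bypass_half r.melon]

end Removal

end MarkedMOGraph

/-! ### Melonic graphs: stability under isomorphism, insertion and removal -/

namespace RootedMOGraph

open MarkedMOGraph

theorem isMelonRemoval_iff (G G' : RootedMOGraph.{u}) :
    G.IsMelonRemoval G' ↔ ∃ a b f, Removal G.toMarkedMOGraph G'.toMarkedMOGraph a b f :=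
  MarkedMOGraph.isMelonRemoval_iff _ _

theorem exists_removal {G : RootedMOGraph.{u}} {a b : G.D} (m : G.MelonAt a b) :
    ∃ (G' : RootedMOGraph.{u}) (f : G'.D → G.D),
      Removal G.toMarkedMOGraph G'.toMarkedMOGraph a b f := by
  obtain ⟨G', f, r⟩ := m.exists_removal
  exact ⟨⟨G', r.connected G.connected⟩, f, r⟩

theorem melonic_of_isEmpty (G : RootedMOGraph.{u}) [IsEmpty G.D] : G.Melonic := by
  refine ⟨G, Relation.ReflTransGen.refl, ⟨⟨Equiv.equivOfIsEmpty _ PEmpty, fun d => isEmptyElim d,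
    fun d => isEmptyElim d, ?_⟩⟩⟩
  rintro (d | c)
  · exact isEmptyElim d
  · have h : G.sign (G.opp (Sum.inr c)) = !c := G.sign_opp_eq (Sum.inr c)
    rcases hc : G.opp (Sum.inr c) with d | s
    · exact isEmptyElim d
    · rw [hc] at h
      change (Sum.inr (!c) : PEmpty ⊕ Bool) = Sum.inr s
      rw [← h]; rfl

theorem Melonic.insertion {G G' : RootedMOGraph.{u}} (h : G'.Melonic) {a b : G.D}
    {f : G'.D → G.D} (r : Removal G.toMarkedMOGraph G'.toMarkedMOGraph a b f) : G.Melonic := by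
  obtain ⟨C, hC, i⟩ := h
  exact ⟨C, Relation.ReflTransGen.head ((isMelonRemoval_iff _ _).2 ⟨a, b, f, r⟩) hC, i⟩

/-- Only the first removal of a reduction has to be transported, since it can be made to land in the
very same smaller graph. With no removal at all, the isomorphism with the cycle-graph is composed
with `φ`. -/
theorem Melonic.congr {G K : RootedMOGraph.{u}} (h : G.Melonic) (φ : Iso G K) : K.Melonic := by
  obtain ⟨C, hC, ⟨i⟩⟩ := h
  rcases hC.cases_head with rfl | ⟨G', h₁, h₂⟩
  · exact ⟨K, Relation.ReflTransGen.refl, ⟨(MarkedMOGraph.Iso.symm φ).trans i⟩⟩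
  · obtain ⟨a, b, f, r⟩ := (isMelonRemoval_iff _ _).1 h₁
    exact ⟨C, Relation.ReflTransGen.head ((isMelonRemoval_iff _ _).2 ⟨_, _, _, r.comp_iso φ⟩) h₂,
      ⟨i⟩⟩

theorem Melonic.exists_melon {G : RootedMOGraph.{u}} (h : G.Melonic) [Nonempty G.D] :
    ∃ a b, G.MelonAt a b := by
  obtain ⟨C, hC, ⟨i⟩⟩ := h
  rcases hC.cases_head with rfl | ⟨G', h₁, -⟩
  · exact (i.toEquiv (Classical.arbitrary _)).elim
  · obtain ⟨a, b, f, r⟩ := (isMelonRemoval_iff _ _).1 h₁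
    exact ⟨a, b, r.melon⟩

/-- A melonic graph remains melonic when any of its melons is removed. -/
theorem Melonic.removal {G G' : RootedMOGraph.{u}} (h : G.Melonic) {a b : G.D}
    {f : G'.D → G.D} (r : Removal G.toMarkedMOGraph G'.toMarkedMOGraph a b f) : G'.Melonic := by
  obtain ⟨C, hC, ⟨i⟩⟩ := h
  revert G'
  induction hC using Relation.ReflTransGen.head_induction_on with
  | refl => exact fun _ => (i.toEquiv a).elim
  | head h₁ h₂ ih =>
    rename_i G₀ G₂
    intro G' f r
    obtain ⟨c, d, g, s⟩ := (isMelonRemoval_iff _ _).1 h₁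
    -- Compare the given melon with the one removed first by the reduction. If they coincide, the
    -- results are isomorphic. Otherwise the diamond gives a common removal `G₃`, melonic by
    -- induction from `G₂`, and `G'` is `G₃` with one melon inserted.
    rcases r.melon.eq_or_disjoint s.melon G₀.connected with ⟨rfl, rfl⟩ | ⟨hc, hd⟩
    · obtain ⟨φ, -⟩ := s.unique r (MarkedMOGraph.Iso.refl _) rfl rfl
      exact Melonic.congr ⟨C, h₂, ⟨i⟩⟩ φ
    · obtain ⟨G₃, c', d', g', a', b', f', r', s'⟩ := r.diamond s hc hd
      have h₃ : RootedMOGraph.Melonic ⟨G₃, r'.connected G'.connected⟩ := ih s'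
      exact h₃.insertion r'

end RootedMOGraph

namespace MarkedMOGraph

/-! ### Melons of a substituted graph -/

/-- With `exists_plug`, this identifies the half-edges of the substituted graph with the disjoint
union of those of the pieces: a half-edge of `H` is a root half-edge of exactly one piece. By
`subst_opp_plug` the pairing acts within each piece. -/
theorem plug_eq_plug {H : MarkedMOGraph.{u}} {M : H.Edge → MarkedMOGraph.{u}} {e e' : H.Edge}
    {x : (M e).Half} {y : (M e').Half} (h : H.plug M e x = H.plug M e' y) :
    (⟨e, x⟩ : Σ e, (M e).Half) = ⟨e', y⟩ := by
  have inj : Function.Injective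
      (Sum.map Sum.inl id : H.Half → (H.D ⊕ Σ e : H.Edge, (M e).D) ⊕ Bool) :=
    Sum.map_injective.2 ⟨Sum.inl_injective, fun _ _ h => h⟩
  have no : ∀ (z : H.Half) (p : Σ e : H.Edge, (M e).D),
      Sum.map Sum.inl id z ≠ (Sum.inl (Sum.inr p) : (H.D ⊕ Σ e : H.Edge, (M e).D) ⊕ Bool) := by
    rintro (d | c) p h <;> cases h
  rcases x with d | c <;> rcases y with d' | c'
  · have := Sum.inr.inj (Sum.inl.inj h)
    cases this
    rfl
  · exact absurd h.symm (no _ _)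
  · exact absurd h (no _ _)
  · have h' : H.halfOf e c = H.halfOf e' c' := inj h
    have h₁ := congrArg H.edgeOf h'
    have h₂ := congrArg H.sign h'
    rw [edgeOf_halfOf, edgeOf_halfOf] at h₁
    rw [sign_halfOf, sign_halfOf] at h₂
    subst h₁ h₂
    rfl

theorem edge_eq_of_plug_eq {H : MarkedMOGraph.{u}} {M : H.Edge → MarkedMOGraph.{u}}
    {e e' : H.Edge} {x : (M e).Half} {y : (M e').Half} (h : H.plug M e x = H.plug M e' y) :
    e = e' := congrArg Sigma.fst (plug_eq_plug h)

theorem plug_injective (H : MarkedMOGraph.{u}) (M : H.Edge → MarkedMOGraph.{u}) (e : H.Edge) :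
    Function.Injective (H.plug M e) := fun x y h => by
  have := plug_eq_plug h
  cases this
  rfl

section

variable {H : MarkedMOGraph.{u}} {M : H.Edge → MarkedMOGraph.{u}}

theorem subst_atVertex_iff {e : H.Edge} {a x : (M e).D} :
    (H.subst M).AtVertex (Sum.inr ⟨e, a⟩) (Sum.inr ⟨e, x⟩) ↔ (M e).AtVertex a x := by
  have key : ∀ y : (M e).D,
      (Sum.inr ⟨e, x⟩ : H.D ⊕ Σ e : H.Edge, (M e).D) = Sum.inr ⟨e, y⟩ ↔ x = y := fun y =>
    ⟨fun h => by cases h; rfl, fun h => by rw [h]⟩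
  exact or_congr (key _) (or_congr (key _) (or_congr (key _) (key _)))

theorem subst_aroundVertex (e : H.Edge) (a : (M e).D) (i : Fin 4) :
    (H.subst M).aroundVertex (Sum.inr ⟨e, a⟩) i = Sum.inr ⟨e, (M e).aroundVertex a i⟩ := by
  fin_cases i <;> rfl

theorem subst_opp_inr {e : H.Edge} {x y : (M e).D} :
    (H.subst M).opp (Sum.inl (Sum.inr ⟨e, x⟩)) = Sum.inl (Sum.inr ⟨e, y⟩) ↔
      (M e).opp (Sum.inl x) = Sum.inl y :=
  ⟨fun h => H.plug_injective M e ((H.subst_opp_plug M e (Sum.inl x)).symm.trans h),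
    fun h => (H.subst_opp_plug M e (Sum.inl x)).trans (congrArg (H.plug M e) h)⟩

theorem subst_melonAt_iff {e : H.Edge} {a b : (M e).D} :
    (H.subst M).MelonAt (Sum.inr ⟨e, a⟩) (Sum.inr ⟨e, b⟩) ↔ (M e).MelonAt a b :=
  ⟨fun m => ⟨m.pos, fun h => m.ne (subst_atVertex_iff.2 h), subst_opp_inr.1 m.opp₁,
      subst_opp_inr.1 m.opp₂, subst_opp_inr.1 m.opp₃⟩,
    fun m => ⟨m.pos, fun h => m.ne (subst_atVertex_iff.1 h), subst_opp_inr.2 m.opp₁,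
      subst_opp_inr.2 m.opp₂, subst_opp_inr.2 m.opp₃⟩⟩

/-- A half-edge of `H` acts as a root half-edge of its piece. If its partner is again a half-edge of
`H`, the piece pairs its two root half-edges, so the partner is the other half of the same edge of
`H`. -/
theorem opp_eq_of_subst_opp_eq {h h' : H.Half}
    (e : (H.subst M).opp (Sum.map Sum.inl id h) = Sum.map Sum.inl id h') : H.opp h = h' := by
  have inj : Function.Injective
      (Sum.map Sum.inl id : H.Half → (H.D ⊕ Σ e : H.Edge, (M e).D) ⊕ Bool) :=
    Sum.map_injective.2 ⟨Sum.inl_injective, fun _ _ h => h⟩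
  have e' := (H.substOpp_map M h).symm.trans e
  have hs := (M (H.edgeOf h)).sign_opp_eq (Sum.inr (H.sign h))
  rcases k : (M (H.edgeOf h)).opp (Sum.inr (H.sign h)) with d | s
  · rw [k] at e'
    rcases h' with d | c <;> cases e'
  · rw [k] at e' hs
    change s = !H.sign h at hs
    rw [hs] at e'
    have e'' : H.halfOf (H.edgeOf h) (!H.sign h) = h' := inj e'
    rw [← opp_halfOf, halfOf_edgeOf] at e''
    exact e''

theorem opp_eq_root_of_subst_opp_eq {d : H.D} {e : H.Edge} {x : (M e).D}
    (h : (H.subst M).opp (Sum.inl (Sum.inr ⟨e, x⟩)) = Sum.inl (Sum.inl d)) :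
    (M e).opp (Sum.inl x) = Sum.inr (H.pos d) := by
  have h' := (H.subst_opp_plug M e (Sum.inl x)).symm.trans h
  rcases k : (M e).opp (Sum.inl x) with y | s
  · rw [k] at h'
    cases h'
  · rw [k] at h'
    change Sum.map Sum.inl id (H.halfOf e s) = _ at h'
    have hs := H.sign_halfOf e s
    rcases hq : H.halfOf e s with d' | c
    · rw [hq] at h' hs
      have := Sum.inl.inj (Sum.inl.inj h')
      subst this
      rw [← hs]; rfl
    · rw [hq] at h'
      cases h'

/-- Opposite half-edges have equal signs, and a piece has a single root half-edge of each sign. This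
rules out a melon with one end-vertex in `H` and the other in a piece, whose first and third edges
would be such a pair. -/
theorem not_two_edges_to_piece {d : H.D} {e : H.Edge} {x : (M e).D}
    (h₁ : (H.subst M).opp (Sum.inl (Sum.inr ⟨e, x⟩)) = Sum.inl (Sum.inl d))
    (h₂ : (H.subst M).opp (Sum.inl (Sum.inr ⟨e, (M e).rot ((M e).rot x)⟩)) =
      Sum.inl (Sum.inl (H.rot (H.rot d)))) : False := by
  have k₁ := opp_eq_root_of_subst_opp_eq h₁
  have k₂ := opp_eq_root_of_subst_opp_eq h₂
  rw [H.pos_rot, H.pos_rot, Bool.not_not, ← k₁] at k₂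
  exact (M e).rot_two_ne x (Sum.inl.inj ((M e).opp_injective k₂))

/-- If `H` is melon-free, every melon of the graph obtained by substituting the edges of `H` lies
inside one of the substituted graphs. -/
theorem MelonFree.exists_piece (hH : H.MelonFree) {k l : (H.subst M).D}
    (m : (H.subst M).MelonAt k l) : ∃ (e : H.Edge) (a b : (M e).D),
      k = Sum.inr ⟨e, a⟩ ∧ l = Sum.inr ⟨e, b⟩ ∧ (M e).MelonAt a b := by
  rcases k with a | ⟨e, a⟩ <;> rcases l with b | ⟨e', b⟩
  · exfalso
    refine H.not_melonFree_iff.2 ⟨a, b, m.pos, fun h => m.ne ?_, ?_, ?_, ?_⟩ hH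
    · exact h.imp (congrArg Sum.inl) (Or.imp (congrArg Sum.inl)
        (Or.imp (congrArg Sum.inl) (congrArg Sum.inl)))
    · exact opp_eq_of_subst_opp_eq (M := M) (h := Sum.inl a) (h' := Sum.inl b) m.opp₁
    · exact opp_eq_of_subst_opp_eq (M := M) (h := Sum.inl (H.rot b))
        (h' := Sum.inl (H.rot (H.rot (H.rot a)))) m.opp₂
    · exact opp_eq_of_subst_opp_eq (M := M) (h := Sum.inl (H.rot (H.rot a)))
        (h' := Sum.inl (H.rot (H.rot b))) m.opp₃
  · exact (not_two_edges_to_piece m.opp_b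
      (((H.subst M).opp_eq_iff _ _).1 m.opp₃).symm).elim
  · exact (not_two_edges_to_piece m.opp₁ m.opp₃).elim
  -- The first edge of the melon cannot leave the piece of `a`, so both end-vertices are in the same
  -- piece.
  · have h := (H.subst_opp_plug M e (Sum.inl a)).symm.trans m.opp₁
    obtain rfl := edge_eq_of_plug_eq (y := Sum.inl b) h
    exact ⟨e, a, b, rfl, rfl, subst_melonAt_iff.1 m⟩

variable {N : H.Edge → MarkedMOGraph.{u}}

/-- Maps of the substituted graphs give a map of the graphs obtained by substitution. -/
def substMap (f : ∀ e, (N e).D → (M e).D) : (H.subst N).D → (H.subst M).D :=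
  Sum.map id (Sigma.map id f)

theorem substMap_plug (f : ∀ e, (N e).D → (M e).D) (e : H.Edge) (x : (N e).Half) :
    (Sum.map (substMap f) id (H.plug N e x : (H.subst N).Half) : (H.subst M).Half) =
      H.plug M e (Sum.map (f e) id x) := by
  rcases x with d | c
  · rfl
  · change Sum.map (substMap f) id (Sum.map Sum.inl id (H.halfOf e c)) =
      Sum.map Sum.inl id (H.halfOf e c)
    rcases H.halfOf e c with d | c <;> rfl

/-- The removal of a melon inside one of the substituted graphs. -/
theorem Removal.subst {f : ∀ e, (N e).D → (M e).D} {e₀ : H.Edge} {a b : (M e₀).D}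
    (r : Removal (M e₀) (N e₀) a b (f e₀))
    (i : ∀ e, e ≠ e₀ → ∃ φ : Iso (N e) (M e), f e = φ.toEquiv) :
    Removal (H.subst M) (H.subst N) (Sum.inr ⟨e₀, a⟩) (Sum.inr ⟨e₀, b⟩) (substMap f) := by
  have no : ∀ (e : H.Edge) (x : (M e).D) (y : (M e₀).D), e ≠ e₀ →
      ¬ (H.subst M).AtVertex (Sum.inr ⟨e₀, y⟩) (Sum.inr ⟨e, x⟩) := by
    rintro e x y he (h | h | h | h) <;> cases h <;> exact he rfl
  have no' : ∀ (d : H.D) (y : (M e₀).D),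
      ¬ (H.subst M).AtVertex (Sum.inr ⟨e₀, y⟩) (Sum.inl d) := by
    rintro d y (h | h | h | h) <;> cases h
  have m := subst_melonAt_iff.2 r.melon
  refine ⟨m, ?_, ?_, ?_, ?_, ?_⟩
  · refine Sum.map_injective.2 ⟨fun _ _ h => h, Function.Injective.sigma_map (fun _ _ h => h) ?_⟩
    intro e
    by_cases he : e = e₀
    · subst he; exact r.inj
    · obtain ⟨φ, hφ⟩ := i e he
      rw [hφ]; exact φ.toEquiv.injective
  · rintro (d | ⟨e, d⟩)
    · exact ⟨fun _ => ⟨no' d a, no' d b⟩, fun _ => ⟨Sum.inl d, rfl⟩⟩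
    · by_cases he : e = e₀
      · subst he
        rw [subst_atVertex_iff, subst_atVertex_iff, ← r.range]
        constructor
        · rintro ⟨x | ⟨e', x⟩, h⟩
          · cases h
          · cases h
            exact ⟨x, rfl⟩
        · rintro ⟨x, rfl⟩
          exact ⟨(Sum.inr ⟨e, x⟩ : H.D ⊕ Σ e : H.Edge, (N e).D), rfl⟩
      · refine ⟨fun _ => ⟨no e d a he, no e d b he⟩, fun _ => ?_⟩
        obtain ⟨φ, hφ⟩ := i e he
        refine ⟨(Sum.inr ⟨e, φ.toEquiv.symm d⟩ : H.D ⊕ Σ e : H.Edge, (N e).D), ?_⟩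
        change (Sum.inr ⟨e, f e _⟩ : H.D ⊕ Σ e : H.Edge, (M e).D) = _
        rw [hφ, Equiv.apply_symm_apply]
  · rintro (d | ⟨e, d⟩)
    · rfl
    · change (M e).pos (f e d) = (N e).pos d
      by_cases he : e = e₀
      · subst he; exact r.pos d
      · obtain ⟨φ, hφ⟩ := i e he
        rw [hφ]; exact φ.map_pos d
  · rintro (d | ⟨e, d⟩)
    · rfl
    · change (Sum.inr ⟨e, (M e).rot (f e d)⟩ : H.D ⊕ Σ e : H.Edge, (M e).D) = Sum.inr ⟨e, f e ((N e).rot d)⟩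
      by_cases he : e = e₀
      · subst he; rw [r.rot]
      · obtain ⟨φ, hφ⟩ := i e he
        rw [hφ, φ.map_rot]
  · intro z
    obtain ⟨e, x, rfl⟩ := H.exists_plug N z
    rw [subst_opp_plug, substMap_plug, substMap_plug, subst_opp_plug]
    by_cases he : e = e₀
    · subst he
      rw [r.opp]
      generalize (M e).opp (Sum.map (f e) id x) = y
      by_cases h₁ : y = Sum.inl ((M e).rot a)
      · rw [h₁, bypass_inlet, ← subst_opp_plug]
        exact (bypass_inlet (G := H.subst M) (a := Sum.inr ⟨e, a⟩) (b := Sum.inr ⟨e, b⟩)).symm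
      by_cases h₂ : y = Sum.inl ((M e).rot ((M e).rot ((M e).rot b)))
      · rw [h₂, r.melon.bypass_outlet, ← subst_opp_plug]
        exact m.bypass_outlet.symm
      rw [bypass_of_ne h₁ h₂]
      symm
      apply bypass_of_ne
      · exact fun h => h₁ (H.plug_injective M e (h : _ = H.plug M e (Sum.inl _)))
      · exact fun h => h₂ (H.plug_injective M e (h : _ = H.plug M e (Sum.inl _)))
    -- In another piece `bypass` has no effect, since the inlet and the outlet are half-edges of the
    -- piece of `e₀`.
    · obtain ⟨φ, hφ⟩ := i e he
      rw [hφ]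
      change H.plug M e (φ.half _) = (H.subst M).bypass _ _ (H.plug M e ((M e).opp (φ.half x)))
      rw [← φ.opp_half]
      symm
      apply bypass_of_ne
      · exact fun h => he (edge_eq_of_plug_eq (M := M) (y := Sum.inl ((M e₀).rot a)) h)
      · exact fun h => he (edge_eq_of_plug_eq (M := M)
          (y := Sum.inl ((M e₀).rot ((M e₀).rot ((M e₀).rot b)))) h)

end

/-- Substituting graphs without ordinary vertices does not change a graph. -/
def substEmptyIso (H : MarkedMOGraph.{u}) (M : H.Edge → MarkedMOGraph.{u})
    [∀ e, IsEmpty (M e).D] : Iso H (H.subst M) where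
  toEquiv :=
    have : IsEmpty (Σ e : H.Edge, (M e).D) := ⟨fun p => isEmptyElim p.2⟩
    (Equiv.sumEmpty H.D (Σ e : H.Edge, (M e).D)).symm
  map_pos _ := rfl
  map_rot _ := rfl
  map_opp h := by
    change H.substOpp M (Sum.map Sum.inl id h) = Sum.map Sum.inl id (H.opp h)
    rw [substOpp_map]
    have hs := (M (H.edgeOf h)).sign_opp_eq (Sum.inr (H.sign h))
    rcases k : (M (H.edgeOf h)).opp (Sum.inr (H.sign h)) with d | s
    · exact isEmptyElim d
    · rw [k] at hs
      change s = !H.sign h at hs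
      change Sum.map Sum.inl id (H.halfOf _ s) = _
      rw [hs, ← opp_halfOf, halfOf_edgeOf]

theorem substEmptyIso_half (H : MarkedMOGraph.{u}) (M : H.Edge → MarkedMOGraph.{u})
    [∀ e, IsEmpty (M e).D] (e : H.Edge) (s : Bool) :
    (H.substEmptyIso M).half (H.halfOf e s) = H.plug M e (Sum.inr s) := rfl

/-- Graphs without ordinary vertices are isomorphic. -/
def Iso.ofIsEmpty (G K : MarkedMOGraph.{u}) [IsEmpty G.D] [IsEmpty K.D] : Iso G K where
  toEquiv := Equiv.equivOfIsEmpty _ _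
  map_pos d := isEmptyElim d
  map_rot d := isEmptyElim d
  map_opp := by
    have key : ∀ (L : MarkedMOGraph.{u}) [IsEmpty L.D] (c : Bool),
        L.opp (Sum.inr c) = Sum.inr (!c) := by
      intro L _ c
      have h : L.sign (L.opp (Sum.inr c)) = !c := L.sign_opp_eq (Sum.inr c)
      rcases hc : L.opp (Sum.inr c) with d | s
      · exact isEmptyElim d
      · rw [hc] at h
        exact congrArg Sum.inr h
    rintro (d | c)
    · exact isEmptyElim d
    · simp [key]

theorem Iso.half_halfOf {G K : MarkedMOGraph.{u}} (φ : Iso G K) (e : G.Edge) (s : Bool) :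
    φ.half (G.halfOf e s) = K.halfOf (φ.mapEdge e) s := by
  cases s
  · exact (φ.opp_half e.1).symm
  · rfl

theorem Iso.mapEdge_injective {G K : MarkedMOGraph.{u}} (φ : Iso G K) :
    Function.Injective φ.mapEdge := fun _ _ h =>
  Subtype.ext (φ.half_injective (congrArg Subtype.val h))

theorem Iso.map_aroundVertex {G K : MarkedMOGraph.{u}} (φ : Iso G K) (a : G.D) (i : Fin 4) :
    φ.toEquiv (G.aroundVertex a i) = K.aroundVertex (φ.toEquiv a) i := by
  fin_cases i <;> simp [aroundVertex, φ.map_rot]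

theorem Removal.card_lt {G G' : MarkedMOGraph.{u}} {a b : G.D} {f : G'.D → G.D}
    (r : Removal G G' a b f) : Nat.card G'.D < Nat.card G.D := by
  have := G'.finite
  have h := Nat.card_congr (Equiv.ofBijective _ r.bijective)
  rw [Nat.card_sum, Nat.card_sum, Nat.card_fin] at h
  omega

end MarkedMOGraph

/-! ### Existence and uniqueness of the core -/

namespace RootedMOGraph

open MarkedMOGraph

/-- The graphs substituted to the edges of `H`, as graphs with a root-vertex. -/
abbrev pieces {H : RootedMOGraph.{u}} (M : H.Edge → RootedMOGraph.{u}) :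
    H.Edge → MarkedMOGraph.{u} := fun e => (M e).toMarkedMOGraph

theorem exists_pieces_removal {H : RootedMOGraph.{u}} (M : H.Edge → RootedMOGraph.{u})
    {e₀ : H.Edge} {a b : (M e₀).D} (m : (M e₀).MelonAt a b) :
    ∃ (N : H.Edge → RootedMOGraph.{u}) (f : ∀ e, (N e).D → (M e).D),
      Removal (M e₀).toMarkedMOGraph (N e₀).toMarkedMOGraph a b (f e₀) ∧
      ∀ e, e ≠ e₀ → ∃ φ : Iso (N e) (M e), f e = φ.toEquiv := by
  -- The type of `a` and `b` depends on `e₀`. Quantifying over `a'`, `b'` with an equality in a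
  -- sigma type states the condition uniformly in `e` without casts, so that `choose` applies.
  have key : ∀ e, ∃ (N : RootedMOGraph.{u}) (f : N.D → (M e).D),
      (∀ a' b', (⟨e, a', b'⟩ : Σ e, (M e).D × (M e).D) = ⟨e₀, a, b⟩ →
        Removal (M e).toMarkedMOGraph N.toMarkedMOGraph a' b' f) ∧
      (e ≠ e₀ → ∃ φ : Iso N (M e), f = φ.toEquiv) := by
    intro e
    by_cases he : e = e₀
    · subst he
      obtain ⟨N, f, r⟩ := RootedMOGraph.exists_removal m
      refine ⟨N, f, fun a' b' h => ?_, fun h => absurd rfl h⟩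
      cases h
      exact r
    · exact ⟨M e, id, fun a' b' h => absurd (congrArg Sigma.fst h) he,
        fun _ => ⟨MarkedMOGraph.Iso.refl _, rfl⟩⟩
  choose N f h₁ h₂ using key
  exact ⟨N, f, h₁ _ _ _ rfl, h₂⟩

theorem exists_pieces_insertion {H : RootedMOGraph.{u}} (N : H.Edge → RootedMOGraph.{u})
    (e₀ : H.Edge) (x : (N e₀).Half) (hx : (N e₀).sign x = true) :
    ∃ (M : H.Edge → RootedMOGraph.{u}) (f : ∀ e, (N e).D → (M e).D) (a b : (M e₀).D),
      Removal (M e₀).toMarkedMOGraph (N e₀).toMarkedMOGraph a b (f e₀) ∧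
      (M e₀).opp (Sum.map (f e₀) id x) = Sum.inl ((M e₀).rot a) ∧
      ∀ e, e ≠ e₀ → ∃ φ : Iso (N e) (M e), f e = φ.toEquiv := by
  have key : ∀ e, ∃ (M : RootedMOGraph.{u}) (f : (N e).D → M.D),
      (∀ x', (⟨e, x'⟩ : Σ e, (N e).Half) = ⟨e₀, x⟩ → ∃ a b,
        Removal M.toMarkedMOGraph (N e).toMarkedMOGraph a b f ∧
        M.opp (Sum.map f id x') = Sum.inl (M.rot a)) ∧
      (e ≠ e₀ → ∃ φ : Iso (N e) M, f = φ.toEquiv) := by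
    intro e
    by_cases he : e = e₀
    · subst he
      have r := (N e).removal_insert x hx
      have o := (N e).opp_insert x hx
      refine ⟨⟨_, r.connected_insertion o (N e).connected⟩, Sum.inl, fun x' h => ?_,
        fun h => absurd rfl h⟩
      cases h
      exact ⟨_, _, r, o⟩
    · exact ⟨N e, id, fun x' h => absurd (congrArg Sigma.fst h) he,
        fun _ => ⟨MarkedMOGraph.Iso.refl _, rfl⟩⟩
  choose M f h₁ h₂ using key
  obtain ⟨a, b, r, o⟩ := h₁ _ _ rfl
  exact ⟨M, f, a, b, r, o, h₂⟩

/-- Existence of the melon-free core. -/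
theorem exists_core (G : RootedMOGraph.{u}) :
    ∃ (H : RootedMOGraph.{u}) (M : H.Edge → RootedMOGraph.{u}),
      H.MelonFree ∧ (∀ e, (M e).Melonic) ∧ Nonempty (Iso G (H.subst M)) ∧
        G.degree = H.degree := by
  induction hn : Nat.card G.D using Nat.strong_induction_on generalizing G with
  | _ n ih =>
    by_cases hG : G.MelonFree
    · have : IsEmpty cycleGraph.{u}.D := inferInstanceAs (IsEmpty PEmpty)
      exact ⟨G, fun _ => cycleGraph, hG, fun _ => melonic_of_isEmpty _,
        ⟨G.substEmptyIso fun _ => cycleGraph.toMarkedMOGraph⟩, rfl⟩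
    · obtain ⟨a, b, m⟩ := G.not_melonFree_iff.1 hG
      obtain ⟨G', f, r⟩ := exists_removal m
      obtain ⟨H, N, hH, hN, ⟨ψ⟩, hd⟩ := ih _ (hn ▸ r.card_lt) G' rfl
      obtain ⟨x, hx⟩ := r.exists_inlet G.connected
      -- Locate the positive half of the merged edge in one of the pieces; the melon is inserted
      -- there, at `y`.
      obtain ⟨e₀, y, hy⟩ := H.exists_plug (pieces N) (ψ.half x)
      have sy : (N e₀).sign y = true := by
        rw [← H.sign_plug (pieces N) e₀ y, ← hy]
        exact (ψ.sign_half x).trans (r.sign_inlet hx)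
      obtain ⟨M, g, c, d, s, hs, i⟩ := exists_pieces_insertion N e₀ y sy
      have S := Removal.subst (M := pieces M) (N := pieces N) s i
      refine ⟨H, M, hH, fun e => ?_, ?_, (r.degree_eq G.connected).trans hd⟩
      · by_cases he : e = e₀
        · subst he
          exact (hN e).insertion s
        · obtain ⟨φ, -⟩ := i e he
          exact (hN e).congr φ
      · obtain ⟨χ, -⟩ := r.unique_insertion S ψ hx (by
          have e := (H.subst_opp_plug (pieces M) e₀ (Sum.map (g e₀) id y)).trans (congrArg _ hs)
          rw [← substMap_plug (M := pieces M) (N := pieces N) g, ← hy] at e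
          exact e)
        exact ⟨χ⟩

/-- Uniqueness of the melon-free core and of the substituted melonic graphs: an isomorphism of the
graphs obtained by substitution comes from isomorphisms of the cores and of the pieces. -/
theorem core_unique {H H' : RootedMOGraph.{u}} (hH : H.MelonFree) (hH' : H'.MelonFree)
    (M : H.Edge → RootedMOGraph.{u}) (M' : H'.Edge → RootedMOGraph.{u})
    (hM : ∀ e, (M e).Melonic) (hM' : ∀ e, (M' e).Melonic)
    (ψ : Iso (H.subst M) (H'.subst M')) :
    ∃ (φ : Iso H H') (χ : ∀ e, Iso (M e) (M' (φ.mapEdge e))), ∀ e x,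
      ψ.half (H.plug (pieces M) e x) = H'.plug (pieces M') (φ.mapEdge e) ((χ e).half x) := by
  -- The cores stay fixed while the pieces shrink. That `ψ` acts piece by piece is part of the
  -- induction claim: it determines in which piece, and on which edge, the removed melon has to be
  -- put back.
  induction hn : Nat.card (H.subst M).D using Nat.strong_induction_on generalizing M M' with
  | _ n ih =>
    by_cases hS : ∃ k l, (H.subst M).MelonAt k l
    · obtain ⟨k, l, m⟩ := hS
      obtain ⟨e₀, a, b, rfl, rfl, m₀⟩ := hH.exists_piece m
      obtain ⟨e₁, c, d, hc, hd, m₁⟩ := hH'.exists_piece (ψ.melonAt m)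
      obtain ⟨N, f, r, i⟩ := exists_pieces_removal M m₀
      obtain ⟨N', f', r', i'⟩ := exists_pieces_removal M' m₁
      have R := Removal.subst (M := pieces M) (N := pieces N) r i
      have R' := Removal.subst (M := pieces M') (N := pieces N') r' i'
      obtain ⟨ω, hω⟩ := R.unique R' ψ hc hd
      have hN : ∀ e, (N e).Melonic := fun e => by
        by_cases he : e = e₀
        · subst he; exact (hM e).removal r
        · obtain ⟨φ, -⟩ := i e he
          exact (hM e).congr (MarkedMOGraph.Iso.symm φ)
      have hN' : ∀ e, (N' e).Melonic := fun e => by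
        by_cases he : e = e₁
        · subst he; exact (hM' e).removal r'
        · obtain ⟨φ, -⟩ := i' e he
          exact (hM' e).congr (MarkedMOGraph.Iso.symm φ)
      obtain ⟨φ, χ, hχ⟩ := ih _ (hn ▸ R.card_lt) N N' hN hN' ω rfl
      have key : ∀ e y, ψ.half (H.plug (pieces M) e (Sum.map (f e) id y)) =
          H'.plug (pieces M') (φ.mapEdge e) (Sum.map (f' (φ.mapEdge e)) id ((χ e).half y)) := by
        intro e y
        have h := hω (H.plug (pieces N) e y)
        rw [substMap_plug] at h
        refine h.symm.trans ?_
        rw [← substMap_plug (M := pieces M') (N := pieces N') f']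
        exact congrArg _ (hχ e y)
      obtain ⟨x, hx⟩ := r.exists_inlet (M e₀).connected
      -- Apply `ψ` to the half-edge facing the inlet: its image faces the inlet of the image melon.
      -- Since edges stay within pieces, this forces `φ.mapEdge e₀ = e₁` and shows that the two
      -- melons are inserted at corresponding edges.
      have hx' : H'.plug (pieces M') (φ.mapEdge e₀)
          ((M' (φ.mapEdge e₀)).opp (Sum.map (f' (φ.mapEdge e₀)) id ((χ e₀).half x))) =
          H'.plug (pieces M') e₁ (Sum.inl ((M' e₁).rot c)) := by
        rw [← subst_opp_plug, ← key]
        refine (ψ.opp_half _).trans ?_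
        have e : (H.subst M).opp (H.plug (pieces M) e₀ (Sum.map (f e₀) id x)) =
            Sum.inl ((H.subst M).rot (Sum.inr ⟨e₀, a⟩)) :=
          (H.subst_opp_plug (pieces M) _ _).trans (congrArg _ hx)
        refine (congrArg ψ.half e).trans (congrArg Sum.inl ?_)
        refine (ψ.map_rot _).symm.trans ?_
        rw [hc]
        rfl
      obtain rfl := edge_eq_of_plug_eq hx'
      have hx'' := H'.plug_injective _ _ hx'
      refine ⟨φ, ?_⟩
      suffices h : ∀ e, ∃ χ : Iso (M e) (M' (φ.mapEdge e)), ∀ x,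
          ψ.half (H.plug (pieces M) e x) =
            H'.plug (pieces M') (φ.mapEdge e) (χ.half x) by
        choose χ hχ using h
        exact ⟨χ, hχ⟩
      intro e
      by_cases he : e = e₀
      · subst he
        obtain ⟨ρ, hρ, ha, hb⟩ := r.unique_insertion r' (χ e) hx hx''
        refine ⟨ρ, r.half_cases (P := fun x => ψ.half (H.plug (pieces M) e x) =
            H'.plug (pieces M') (φ.mapEdge e) (ρ.half x)) (fun y => ?_) (fun j => ?_) fun j => ?_⟩
        · rw [key, hρ]
        · have h := ψ.map_aroundVertex (Sum.inr ⟨e, a⟩) j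
          rw [hc] at h
          erw [subst_aroundVertex, subst_aroundVertex] at h
          rw [Iso.half_inl, ρ.map_aroundVertex, ha]
          exact congrArg Sum.inl h
        · have h := ψ.map_aroundVertex (Sum.inr ⟨e, b⟩) j
          rw [hd] at h
          erw [subst_aroundVertex, subst_aroundVertex] at h
          rw [Iso.half_inl, ρ.map_aroundVertex, hb]
          exact congrArg Sum.inl h
      · obtain ⟨α, hα⟩ := i e he
        obtain ⟨β, hβ⟩ := i' _ fun h => he (φ.mapEdge_injective h)
        refine ⟨((MarkedMOGraph.Iso.symm α).trans (χ e)).trans β, fun x => ?_⟩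
        have h := key e ((MarkedMOGraph.Iso.symm α).half x)
        rw [hα, hβ] at h
        rw [Iso.half_trans, Iso.half_trans]
        refine Eq.trans ?_ h
        exact congrArg (fun z => ψ.half (H.plug (pieces M) e z)) (α.half_half_symm x).symm
    -- A nonempty melonic piece would contain a melon, hence so would the substituted graph. All
    -- pieces are therefore trivial and `ψ` is an isomorphism of the cores.
    · have emp : ∀ e, IsEmpty (pieces M e).D := fun e => by
        by_contra h
        have := not_isEmpty_iff.1 h
        obtain ⟨a, b, m⟩ := (hM e).exists_melon
        exact hS ⟨_, _, subst_melonAt_iff.2 m⟩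
      have emp' : ∀ e, IsEmpty (pieces M' e).D := fun e => by
        by_contra h
        have := not_isEmpty_iff.1 h
        obtain ⟨a, b, m⟩ := (hM' e).exists_melon
        exact hS ⟨_, _, (MarkedMOGraph.Iso.symm ψ).melonAt
          (subst_melonAt_iff (M := pieces M').2 m)⟩
      let φ : Iso H H' := ((H.substEmptyIso (pieces M)).trans ψ).trans
        (MarkedMOGraph.Iso.symm (H'.substEmptyIso (pieces M')))
      refine ⟨φ, fun e => MarkedMOGraph.Iso.ofIsEmpty (pieces M e) (pieces M' (φ.mapEdge e)), ?_⟩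
      rintro e (x | s)
      · exact (emp e).elim x
      · rw [← substEmptyIso_half, Iso.half_inr, ← substEmptyIso_half, ← Iso.half_halfOf]
        exact ((H'.substEmptyIso (pieces M')).half_half_symm _).symm.trans
          (congrArg _ ((Iso.half_trans _ _ _).trans
            (congrArg _ (Iso.half_trans (H.substEmptyIso (pieces M)) ψ _))).symm)

end RootedMOGraph

/-- Every rooted MO-graph is obtained, uniquely up to isomorphism, from a rooted melon-free
MO-graph by substituting every edge by a rooted melonic MO-graph, and both have the same degree. -/
theorem mainTheorem8 (G : RootedMOGraph.{u}) :
    ∃ (H : RootedMOGraph.{u}) (M : H.Edge → RootedMOGraph.{u}),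
      (H.MelonFree ∧ (∀ e, (M e).Melonic) ∧ Nonempty (RootedMOGraph.Iso G (H.subst M))) ∧
      (∀ (H' : RootedMOGraph.{u}) (M' : H'.Edge → RootedMOGraph.{u}),
        H'.MelonFree → (∀ e, (M' e).Melonic) → Nonempty (RootedMOGraph.Iso G (H'.subst M')) →
        ∃ φ : RootedMOGraph.Iso H H',
          ∀ e, Nonempty (RootedMOGraph.Iso (M e) (M' (φ.mapEdge e)))) ∧
      G.degree = H.degree := by
  obtain ⟨H, M, hH, hM, ⟨ψ⟩, hd⟩ := G.exists_core
  refine ⟨H, M, ⟨hH, hM, ⟨ψ⟩⟩, fun H' M' hH' hM' ⟨ψ'⟩ => ?_, hd⟩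
  obtain ⟨φ, χ, -⟩ := RootedMOGraph.core_unique hH hH' M M' hM hM'
    ((MarkedMOGraph.Iso.symm ψ).trans ψ')
  exact ⟨φ, fun e => ⟨χ e⟩⟩
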